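/- **Setting.** A dyadic interval is a set $[j2^n,(j+1)2^n)$ with $j,n\in\mathbb Z$, and a dyadic rectangle is a product $R=I\times J\subset\mathbb R^2$ of two dyadic intervals. For $0<\eta<1$ a collection $\mathcal S$ of dyadic rectangles is $\eta$-sparse if for every $R\in\mathcal S$ there is a measurable $E(R)\subseteq R$ with $|E(R)|\ge\eta|R|$, the sets $E(R)$, $R\in\mathcal S$, being pairwise disjoint. Write $\langle |f|\rangle_R=\frac1{|R|}\int_R|f|$ and $$\langle |f|\rangle_{R,\phi}=\inf\Bigl\{\lambda>0:\ \frac1{|R|}\int_R\phi\Bigl(\frac{|f(x)|}{\lambda}\Bigr)\,dx\le 1\Bigr\}.$$ An operator $T$ admits $(\phi,1)$-sparse domination if there are $C>0$ and $0<\eta<1$ such that for all bounded, measurable, compactly supported $f,g:\mathbb R^2\to\mathbb R$ there is an $\eta$-sparse collection $\mathcal S$ of dyadic rectangles with $$|\langle Tf,g\rangle|\le C\sum_{R\in\mathcal S}\langle|f|\rangle_{R,\phi}\,\langle|g|\rangle_R\,|R|.$$ The dyadic strong maximal function is $\mathcal M_Sf(x)=\sup_{R\ni x}\langle|f|\rangle_R$,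 the supremum being over all dyadic rectangles containing $x$. For $R=I\times J$ let $h_R=h_I\otimes h_J$ be the $L^2$-normalized Haar function, $h_I=|I|^{-1/2}(\mathbb 1_{I_{\rm left}}-\mathbb 1_{I_{\rm right}})$, where $I_{\rm left},I_{\rm right}$ are the two halves of $I$. For a family $\sigma=(\sigma_R)$ of real numbers with $|\sigma_R|\le1$, indexed by the dyadic rectangles, the martingale transform is $T_\sigma f=\sum_R\sigma_R\langle f,h_R\rangle h_R$ (convergence in $L^2(\mathbb R^2)$). **Theorem 4.4.** Let $0<\alpha<\frac12$ and $\phi(x)=x[\log(e+x)]^\alpha$. Then $\mathcal M_S$ does not admit $(\phi,1)$-sparse domination. Moreover, there is a family $\sigma$ with $|\sigma_R|\le 1$ for all $R$ such that the martingale transform $T_\sigma$ does not admit $(\phi,1)$-sparse domination. -/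

import Mathlib

open MeasureTheory
open scoped ENNReal

namespace SparseForms

/-- A dyadic interval of the real line, coded as `(n, j)`; it stands for `[j 2ⁿ, (j + 1) 2ⁿ)`.
Different codes give different intervals. -/
abbrev DyadicInterval := ℤ × ℤ

/-- The half-open interval `[j 2ⁿ, (j + 1) 2ⁿ)` coded by `(n, j)`. -/
def DyadicInterval.toSet (I : DyadicInterval) : Set ℝ :=
  Set.Ico ((I.2 : ℝ) * (2 : ℝ) ^ I.1) (((I.2 : ℝ) + 1) * (2 : ℝ) ^ I.1)

/-- The left half of a dyadic interval. -/
def DyadicInterval.left (I : DyadicInterval) : DyadicInterval := (I.1 - 1, 2 * I.2)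

/-- The right half of a dyadic interval. -/
def DyadicInterval.right (I : DyadicInterval) : DyadicInterval := (I.1 - 1, 2 * I.2 + 1)

/-- A dyadic rectangle with sides parallel to the axes: a pair of dyadic intervals. -/
abbrev DyadicRect := DyadicInterval × DyadicInterval

/-- The subset `I × J` of the plane. -/
def DyadicRect.toSet (R : DyadicRect) : Set (ℝ × ℝ) :=
  DyadicInterval.toSet R.1 ×ˢ DyadicInterval.toSet R.2

/-- A collection `S` of dyadic rectangles is `η`-sparse if every `R ∈ S` has a measurable subset
`E R` with `|E R| ≥ η |R|`, the sets `E R` being pairwise disjoint. -/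
def IsSparse (η : ℝ) (S : Set DyadicRect) : Prop :=
  ∃ E : DyadicRect → Set (ℝ × ℝ),
    (∀ R ∈ S, MeasurableSet (E R) ∧ E R ⊆ DyadicRect.toSet R ∧
      ENNReal.ofReal η * volume (DyadicRect.toSet R) ≤ volume (E R)) ∧
    S.PairwiseDisjoint E

/-- The average `⟨|f|⟩_R`. -/
noncomputable def rectAverage (f : ℝ × ℝ → ℝ) (R : DyadicRect) : ℝ≥0∞ :=
  (∫⁻ x in DyadicRect.toSet R, ENNReal.ofReal |f x|) / volume (DyadicRect.toSet R)

/-- The Orlicz average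
`⟨|f|⟩_{R,φ} = inf {t > 0 : |R|⁻¹ ∫_R φ(|f(x)| / t) dx ≤ 1}` (it is `∞` if there is no such `t`). -/
noncomputable def orliczAverage (φ : ℝ → ℝ) (f : ℝ × ℝ → ℝ) (R : DyadicRect) : ℝ≥0∞ :=
  sInf {s : ℝ≥0∞ | ∃ t : ℝ, 0 < t ∧ s = ENNReal.ofReal t ∧
    (∫⁻ x in DyadicRect.toSet R, ENNReal.ofReal (φ (|f x| / t))) /
      volume (DyadicRect.toSet R) ≤ 1}

/-- The `(φ, 1)` sparse form
`∑_{R ∈ S} ⟨|f|⟩_{R,φ} ⟨|g|⟩_R |R|`, with values in `[0, ∞]`. -/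
noncomputable def sparseForm (φ : ℝ → ℝ) (S : Set DyadicRect) (f g : ℝ × ℝ → ℝ) : ℝ≥0∞ :=
  ∑' R : S, orliczAverage φ f R * rectAverage g R * volume (DyadicRect.toSet R)

/-- Bounded measurable functions of compact support. -/
structure IsTestFunction (f : ℝ × ℝ → ℝ) : Prop where
  measurable : Measurable f
  bounded : ∃ M : ℝ, ∀ x, |f x| ≤ M
  hasCompactSupport : HasCompactSupport f

/-- `(φ, 1)`-type sparse domination of an operator `T`: there are `C > 0` and `0 < η < 1` such that
for all bounded, compactly supported `f` and `g` there is an `η`-sparse collection `S` of dyadic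
rectangles with `|⟨T f, g⟩| ≤ C ∑_{R ∈ S} ⟨|f|⟩_{R,φ} ⟨|g|⟩_R |R|`. -/
def HasSparseDomination (φ : ℝ → ℝ) (T : (ℝ × ℝ → ℝ) → (ℝ × ℝ → ℝ)) : Prop :=
  ∃ C : ℝ, 0 < C ∧ ∃ η : ℝ, 0 < η ∧ η < 1 ∧
    ∀ f g : ℝ × ℝ → ℝ, IsTestFunction f → IsTestFunction g →
      ∃ S : Set DyadicRect, IsSparse η S ∧
        ENNReal.ofReal |∫ x, T f x * g x| ≤ ENNReal.ofReal C * sparseForm φ S f g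

/-- The dyadic strong maximal function: the supremum of `⟨|f|⟩_R` over all dyadic rectangles
`R` that contain `x` (it is finite everywhere when `f` is bounded). -/
noncomputable def strongMaximal (f : ℝ × ℝ → ℝ) (x : ℝ × ℝ) : ℝ :=
  (⨆ R : DyadicRect, ⨆ _ : x ∈ DyadicRect.toSet R, rectAverage f R).toReal

/-- The `L²`-normalized Haar function `|I|^{-1/2} (1_{left half} - 1_{right half})`. -/
noncomputable def haarInterval (I : DyadicInterval) (x : ℝ) : ℝ :=
  (Real.sqrt ((2 : ℝ) ^ I.1))⁻¹ *
    ((DyadicInterval.toSet (DyadicInterval.left I)).indicator 1 x -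
      (DyadicInterval.toSet (DyadicInterval.right I)).indicator 1 x)

/-- The bi-parameter Haar function `h_R(x, y) = h_I(x) h_J(y)` of `R = I × J`. -/
noncomputable def haar (R : DyadicRect) (x : ℝ × ℝ) : ℝ :=
  haarInterval R.1 x.1 * haarInterval R.2 x.2

theorem memLp_haarInterval (I : DyadicInterval) :
    MemLp (haarInterval I) 2 (volume : Measure ℝ) := by
  have h : ∀ K : DyadicInterval,
      MemLp ((DyadicInterval.toSet K).indicator (1 : ℝ → ℝ)) 2 (volume : Measure ℝ) := by
    intro K
    refine memLp_indicator_const 2 measurableSet_Ico (1 : ℝ) (Or.inr ?_)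
    simp
  exact ((h _).sub (h _)).const_mul _

theorem memLp_haar (R : DyadicRect) : MemLp (haar R) 2 (volume : Measure (ℝ × ℝ)) := by
  have h1 := memLp_haarInterval R.1
  have h2 := memLp_haarInterval R.2
  have hm : AEStronglyMeasurable (haar R) (volume : Measure (ℝ × ℝ)) :=
    (h1.1.comp_fst).mul (h2.1.comp_snd)
  refine (memLp_two_iff_integrable_sq hm).2 ?_
  have h := ((memLp_two_iff_integrable_sq h1.1).1 h1).mul_prod
    ((memLp_two_iff_integrable_sq h2.1).1 h2)
  simp only [haar, mul_pow]
  exact h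

/-- The martingale transform `T_σ f = ∑_R σ_R ⟨f, h_R⟩ h_R`, the sum over all dyadic rectangles
being taken in `L²(ℝ²)` (it converges unconditionally there when `f ∈ L²` and `σ` is bounded,
because the functions `h_R` are orthonormal). -/
noncomputable def martingaleTransform (σ : DyadicRect → ℝ) (f : ℝ × ℝ → ℝ) : ℝ × ℝ → ℝ :=
  ⇑(∑' R : DyadicRect, (σ R * ∫ x, f x * haar R x) • (memLp_haar R).toLp (haar R) :
    Lp ℝ 2 (volume : Measure (ℝ × ℝ)))

end SparseForms

open SparseForms

namespace SparseForms

/-! ### Dyadic intervals -/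

/-! The extremal pair comes from bit reversal. Put `M = 4 ^ k`, `m = M + k`. A word `c` of `m`
binary digits gives the source point whose abscissa has the digits `c` and whose ordinate has the
reversed digits. A dyadic rectangle with sides `2 ^ (-A)`, `2 ^ (-B)`, both at most 1, fixes the
first `A` and the last `B` digits, so it holds at most `max 1 (2 ^ (m - A - B))` source points. For
each `c` and each `i < M`, flipping all digits of the abscissa from place `k + i` on and all digits
of the ordinate from place `M + k - i` on gives a target point. Let `f` and `g` be unit masses
spread evenly over tiny squares at the source and the target points.

Lower bound: source `c` and target `(c, i)` lie in a common link rectangle of measure `2 ^ (-(m +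
k))`, which contains mass `2 ^ (-m)` of `f`. Hence the maximal function of `f` is at least `2 ^ k`
on the support of `g`, and its pairing with `g` is at least `2 ^ k`. The two flips change both Haar
signs, so the Haar function of the link rectangle has the same value on both squares; a link
rectangle meets no other source or target square, and the transform that keeps exactly the link
rectangles pairs to `2 ^ k` as well.

Upper bound: for every dyadic rectangle inside the unit square, the product of the averages of `f`
and `g` is at most 1. This rests on the separation `add_le_of_agree` and the count `card_pairs_le`.
The Orlicz average of `f` costs only a further factor of order `M ^ α = 4 ^ (α * k)`, because `f` is
at most exponential in its depth. Rectangles with long sides are absorbed by an integrable weight,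
and sparseness bounds the sum (`sparse_term_le`, `sparseForm_le`). For `α < 1 / 2` the bound `4 ^ (α
* k)` is eventually beaten by `2 ^ k`. -/

theorem DyadicInterval.mem_toSet {I : DyadicInterval} {x : ℝ} :
    x ∈ I.toSet ↔ (I.2 : ℝ) * (2 : ℝ) ^ I.1 ≤ x ∧ x < ((I.2 : ℝ) + 1) * (2 : ℝ) ^ I.1 := Iff.rfl

theorem DyadicInterval.measurableSet_toSet (I : DyadicInterval) : MeasurableSet I.toSet :=
  measurableSet_Ico

theorem DyadicInterval.volume_toSet (I : DyadicInterval) :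
    volume I.toSet = ENNReal.ofReal ((2 : ℝ) ^ I.1) := by
  rw [DyadicInterval.toSet, Real.volume_Ico]
  congr 1
  ring

theorem DyadicInterval.subset_of_mem {I J : DyadicInterval} (h : I.1 ≤ J.1) {x : ℝ}
    (hI : x ∈ I.toSet) (hJ : x ∈ J.toSet) : I.toSet ⊆ J.toSet := by
  obtain ⟨n, i⟩ := I
  obtain ⟨n', j⟩ := J
  obtain ⟨d, rfl⟩ : ∃ d : ℕ, n' = n + d := ⟨(n' - n).toNat, by simp at h; omega⟩
  simp only [DyadicInterval.mem_toSet, zpow_add₀ (two_ne_zero' ℝ), zpow_natCast] at hI hJ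
  have hp : (0 : ℝ) < 2 ^ n := by positivity
  have h1 : (j : ℝ) * 2 ^ d < i + 1 := by
    by_contra! h'
    nlinarith
  have h2 : (i : ℝ) < (j + 1) * 2 ^ d := by
    by_contra! h'
    nlinarith
  have h1' : j * 2 ^ d ≤ i := by
    have : j * 2 ^ d < i + 1 := by exact_mod_cast h1
    omega
  have h2' : i + 1 ≤ (j + 1) * 2 ^ d := by
    have : i < (j + 1) * 2 ^ d := by exact_mod_cast h2
    omega
  have h1'' : (j : ℝ) * 2 ^ d ≤ i := by exact_mod_cast h1'
  have h2'' : (i : ℝ) + 1 ≤ (j + 1) * 2 ^ d := by exact_mod_cast h2'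
  intro y hy
  simp only [DyadicInterval.mem_toSet, zpow_add₀ (two_ne_zero' ℝ), zpow_natCast] at hy ⊢
  constructor <;> nlinarith

theorem DyadicInterval.eq_of_mem {I J : DyadicInterval} (h : I.1 = J.1) {x : ℝ}
    (hI : x ∈ I.toSet) (hJ : x ∈ J.toSet) : I = J := by
  obtain ⟨n, i⟩ := I
  obtain ⟨n', j⟩ := J
  obtain rfl : n = n' := h
  simp only [DyadicInterval.mem_toSet] at hI hJ
  have hp : (0 : ℝ) < 2 ^ n := by positivity
  have h1 : (j : ℝ) < i + 1 := by
    by_contra! h'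
    nlinarith
  have h2 : (i : ℝ) < j + 1 := by
    by_contra! h'
    nlinarith
  have h1' : j < i + 1 := by exact_mod_cast h1
  have h2' : i < j + 1 := by exact_mod_cast h2
  simp
  omega

theorem DyadicInterval.exists_mem (n : ℤ) (x : ℝ) :
    ∃ I : DyadicInterval, I.1 = n ∧ x ∈ I.toSet := by
  have hp : (0 : ℝ) < 2 ^ n := by positivity
  refine ⟨(n, ⌊x / 2 ^ n⌋), rfl, ?_, ?_⟩
  · exact (le_div_iff₀ hp).1 (Int.floor_le _)
  · exact (div_lt_iff₀ hp).1 (Int.lt_floor_add_one _)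

theorem DyadicInterval.left_subset (I : DyadicInterval) : I.left.toSet ⊆ I.toSet := by
  intro x hx
  have hp : (0 : ℝ) < 2 ^ I.1 := by positivity
  simp only [DyadicInterval.mem_toSet, DyadicInterval.left, zpow_sub_one₀ (two_ne_zero' ℝ)] at hx ⊢
  push_cast at hx
  constructor <;> nlinarith

theorem DyadicInterval.right_subset (I : DyadicInterval) : I.right.toSet ⊆ I.toSet := by
  intro x hx
  have hp : (0 : ℝ) < 2 ^ I.1 := by positivity
  simp only [DyadicInterval.mem_toSet, DyadicInterval.right, zpow_sub_one₀ (two_ne_zero' ℝ)] at hx ⊢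
  push_cast at hx
  constructor <;> nlinarith

theorem DyadicInterval.disjoint_left_right (I : DyadicInterval) :
    Disjoint I.left.toSet I.right.toSet := by
  rw [Set.disjoint_left]
  intro x h1 h2
  have := DyadicInterval.eq_of_mem (I := I.left) (J := I.right) rfl h1 h2
  simp only [DyadicInterval.left, DyadicInterval.right, Prod.mk.injEq] at this
  omega

theorem haarInterval_eq_zero {I : DyadicInterval} {x : ℝ} (hx : x ∉ I.toSet) :
    haarInterval I x = 0 := by
  rw [haarInterval, Set.indicator_of_notMem (fun h => hx (I.left_subset h)),
    Set.indicator_of_notMem (fun h => hx (I.right_subset h))]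
  simp

theorem haar_eq_zero {R : DyadicRect} {x : ℝ × ℝ} (hx : x ∉ R.toSet) : haar R x = 0 := by
  rw [DyadicRect.toSet, Set.mem_prod, not_and_or] at hx
  rcases hx with h | h <;> simp [haar, haarInterval_eq_zero h]

theorem DyadicRect.measurableSet_toSet (R : DyadicRect) : MeasurableSet R.toSet :=
  R.1.measurableSet_toSet.prod R.2.measurableSet_toSet

theorem DyadicRect.volume_toSet (R : DyadicRect) :
    volume R.toSet = ENNReal.ofReal ((2 : ℝ) ^ R.1.1 * (2 : ℝ) ^ R.2.1) := by
  rw [DyadicRect.toSet, Measure.volume_eq_prod, Measure.prod_prod, DyadicInterval.volume_toSet,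
    DyadicInterval.volume_toSet, ENNReal.ofReal_mul (by positivity)]

theorem DyadicRect.volume_ne_zero (R : DyadicRect) : volume R.toSet ≠ 0 := by
  rw [R.volume_toSet, ENNReal.ofReal_ne_zero_iff]
  positivity

theorem DyadicRect.volume_ne_top (R : DyadicRect) : volume R.toSet ≠ ∞ := by
  rw [R.volume_toSet]
  exact ENNReal.ofReal_ne_top

/-! ### Binary expansions -/

/-- The integer whose binary expansion is that of `s` followed by the first `n` digits of `d`. -/
def prefixCode (s : ℤ) (d : ℕ → Bool) : ℕ → ℤ
  | 0 => s
  | n + 1 => 2 * prefixCode s d n + (if d n then 1 else 0)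

/-- The dyadic interval of length `2⁻ⁿ` in `[s, s + 1)` of the numbers whose fractional part has a
binary expansion that starts with the first `n` digits of `d`. -/
def cell (s : ℤ) (d : ℕ → Bool) (n : ℕ) : DyadicInterval := (-(n : ℤ), prefixCode s d n)

theorem prefixCode_inj {s : ℤ} {d d' : ℕ → Bool} {n : ℕ} :
    prefixCode s d n = prefixCode s d' n ↔ ∀ i < n, d i = d' i := by
  induction n with
  | zero => simp [prefixCode]
  | succ n ih =>
    rw [Nat.forall_lt_succ_right, ← ih, prefixCode, prefixCode]
    cases d n <;> cases d' n <;> simp <;> omega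

theorem cell_inj {s : ℤ} {d d' : ℕ → Bool} {n : ℕ} :
    cell s d n = cell s d' n ↔ ∀ i < n, d i = d' i := by
  rw [← prefixCode_inj (s := s)]
  simp [cell]

theorem cell_succ (s : ℤ) (d : ℕ → Bool) (n : ℕ) :
    cell s d (n + 1) = if d n then (cell s d n).right else (cell s d n).left := by
  cases h : d n <;>
    simp [cell, prefixCode, DyadicInterval.left, DyadicInterval.right, h] <;> ring

theorem cell_antitone (s : ℤ) (d : ℕ → Bool) : Antitone fun n => (cell s d n).toSet := by
  refine antitone_nat_of_succ_le fun n => ?_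
  simp only [cell_succ]
  split_ifs
  · exact DyadicInterval.right_subset _
  · exact DyadicInterval.left_subset _

/-- The side, `1` or `-1`, of the cell of `d` with respect to the digit `n`. -/
def digitSign (d : ℕ → Bool) (n : ℕ) : ℝ := if d n then -1 else 1

theorem haarInterval_cell {s : ℤ} {d : ℕ → Bool} {n N : ℕ} (h : n < N) {x : ℝ}
    (hx : x ∈ (cell s d N).toSet) :
    haarInterval (cell s d n) x = (Real.sqrt ((2 : ℝ) ^ (-(n : ℤ))))⁻¹ * digitSign d n := by
  have hx' : x ∈ (cell s d (n + 1)).toSet := cell_antitone s d h hx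
  rw [cell_succ] at hx'
  rw [haarInterval, digitSign]
  have hd := (cell s d n).disjoint_left_right
  split_ifs at hx' ⊢ with hdn
  · rw [Set.indicator_of_notMem (Set.disjoint_right.1 hd hx'), Set.indicator_of_mem hx']
    simp [cell]
  · rw [Set.indicator_of_notMem (Set.disjoint_left.1 hd hx'), Set.indicator_of_mem hx']
    simp [cell]

theorem eq_cell_of_mem {I : DyadicInterval} {s : ℤ} {d : ℕ → Bool} {n N : ℕ} (hn : I.1 = -(n : ℤ))
    (h : n ≤ N) {x : ℝ} (hI : x ∈ I.toSet) (hx : x ∈ (cell s d N).toSet) : I = cell s d n :=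
  DyadicInterval.eq_of_mem hn hI (cell_antitone s d h hx)

/-- Two expansions whose `N`-cells meet the same dyadic interval agree up to its scale. -/
theorem agree_of_mem {I : DyadicInterval} {s : ℤ} {d d' : ℕ → Bool} {N : ℕ} {x x' : ℝ}
    (hx : x ∈ I.toSet) (hd : x ∈ (cell s d N).toSet) (hx' : x' ∈ I.toSet)
    (hd' : x' ∈ (cell s d' N).toSet) : ∀ i < min (-I.1).toNat N, d i = d' i := by
  rw [← cell_inj (s := s)]
  obtain ⟨J, hJ1, hJ⟩ := DyadicInterval.exists_mem (-((min (-I.1).toNat N : ℕ) : ℤ)) x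
  rcases le_or_gt I.1 0 with h0 | h0
  · have hsub : I.toSet ⊆ J.toSet := DyadicInterval.subset_of_mem (by rw [hJ1]; omega) hx hJ
    rw [← eq_cell_of_mem hJ1 (min_le_right _ _) hJ hd,
      ← eq_cell_of_mem hJ1 (min_le_right _ _) (hsub hx') hd']
  · have : min (-I.1).toNat N = 0 := by omega
    rw [this]
    simp [cell, prefixCode]

/-! ### Two separated families of binary expansions -/

/-- A finite sequence of digits, continued by zeros. -/
def pad {m : ℕ} (c : Fin m → Bool) (i : ℕ) : Bool := if h : i < m then c ⟨i, h⟩ else false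

/-- Flip all the digits from place `a` on. -/
def flipFrom (a : ℕ) (d : ℕ → Bool) (i : ℕ) : Bool := if i < a then d i else !d i

theorem pad_of_le {m : ℕ} (c : Fin m → Bool) {i : ℕ} (h : m ≤ i) : pad c i = false := by
  simp [pad, h]

theorem pad_rev {m : ℕ} (c : Fin m → Bool) {i : ℕ} (h : i < m) :
    pad (c ∘ Fin.rev) i = pad c (m - 1 - i) := by
  have h' : m - 1 - i < m := by omega
  simp only [pad, h, h', dif_pos, Function.comp]
  congr 1
  ext
  simp [Fin.rev]
  omega

theorem pad_ext {m : ℕ} {c c' : Fin m → Bool} (h : ∀ i < m, pad c i = pad c' i) : c = c' := by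
  ext i
  have := h i i.2
  simpa [pad] using this

theorem flipFrom_of_lt {a i : ℕ} (d : ℕ → Bool) (h : i < a) : flipFrom a d i = d i := by
  simp [flipFrom, h]

theorem flipFrom_of_le {a i : ℕ} (d : ℕ → Bool) (h : a ≤ i) : flipFrom a d i = !d i := by
  simp [flipFrom, h]

theorem flipFrom_eq_flipFrom {a i : ℕ} {d d' : ℕ → Bool} :
    flipFrom a d i = flipFrom a d' i ↔ d i = d' i := by
  rw [flipFrom, flipFrom]
  split_ifs <;> simp

theorem le_of_flipFrom_agree {a A : ℕ} {d : ℕ → Bool} (h : ∀ i < A, d i = flipFrom a d i) :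
    A ≤ a := by
  by_contra! hlt
  have := h a hlt
  rw [flipFrom_of_le d le_rfl] at this
  simp at this

/-- The zeros of the padding become ones under the flip, so agreement cannot pass place `m`. -/
theorem le_of_flipFrom_pad_agree {m a A : ℕ} {c c' : Fin m → Bool} (ha : a ≤ m)
    (h : ∀ i < A, pad c' i = flipFrom a (pad c) i) : A ≤ m := by
  by_contra! hlt
  have := h m hlt
  rw [flipFrom_of_le _ ha, pad_of_le _ le_rfl, pad_of_le _ le_rfl] at this
  simp at this

/-- The separation of the two families: `c'` and the flip of another `c` agree in at most `m`
digits altogether. -/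
theorem add_le_of_agree {m k a b A B : ℕ} {c c' : Fin m → Bool} (hne : c' ≠ c)
    (hab : a + b = m + k) (ha : a ≤ m) (hb : b ≤ m)
    (hA : ∀ i < A, pad c' i = flipFrom a (pad c) i)
    (hB : ∀ i < B, pad (c' ∘ Fin.rev) i = flipFrom b (pad (c ∘ Fin.rev)) i) : A + B ≤ m := by
  have hAm : A ≤ m := le_of_flipFrom_pad_agree ha hA
  have hBm : B ≤ m := le_of_flipFrom_pad_agree hb hB
  by_contra! hlt
  -- Digit `j` is digit `m - 1 - j` of the reversed word; there it is compared when `m - B ≤ j` and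
  -- is unflipped when `m - b ≤ j`.
  have hB1 : ∀ j < m, m - B ≤ j → m - b ≤ j → pad c' j = pad c j := by
    intro j hj h1 h2
    have := hB (m - 1 - j) (by omega)
    rwa [flipFrom_of_lt _ (by omega), pad_rev _ (by omega), pad_rev _ (by omega),
      show m - 1 - (m - 1 - j) = j by omega] at this
  -- If `A + B > m`, the two comparisons together see every digit. A flipped digit seen from one
  -- side would be seen unflipped from the other, since `a + b ≥ m`; hence no flip is seen and the
  -- words coincide.
  rcases le_or_gt A a with h | h
  · have hBb : B ≤ b := by
      by_contra! hBb
      have h1 := hB (B - 1) (by omega)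
      rw [flipFrom_of_le _ (by omega), pad_rev _ (by omega), pad_rev _ (by omega),
        hA (m - 1 - (B - 1)) (by omega), flipFrom_of_lt _ (by omega)] at h1
      simp at h1
    refine hne (pad_ext fun j hj => ?_)
    rcases lt_or_ge j A with hjA | hjA
    · rw [hA j hjA, flipFrom_of_lt _ (by omega)]
    · exact hB1 j hj (by omega) (by omega)
  · have h1 := hA (A - 1) (by omega)
    rw [flipFrom_of_le _ (by omega), hB1 (A - 1) (by omega) (by omega) (by omega)] at h1
    simp at h1

/-- Sequences that agree pairwise in their first `A` and their last `B` digits. -/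
theorem card_le_of_agree {m A B : ℕ} (S : Finset (Fin m → Bool))
    (hA : ∀ c ∈ S, ∀ c' ∈ S, ∀ i < A, pad c i = pad c' i)
    (hB : ∀ c ∈ S, ∀ c' ∈ S, ∀ i < B, pad (c ∘ Fin.rev) i = pad (c' ∘ Fin.rev) i) :
    S.card ≤ 2 ^ (m - (A + B)) := by
  -- Only the `m - (A + B)` middle digits are free; if `A + B ≥ m` none are.
  have hinj : Set.InjOn (fun (c : Fin m → Bool) (i : Fin (m - (A + B))) => pad c (A + i)) S := by
    intro c hc c' hc' h
    refine pad_ext fun j hj => ?_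
    rcases lt_or_ge j A with h1 | h1
    · exact hA c hc c' hc' j h1
    · by_cases h2 : j < m - B
      · have := congrFun h ⟨j - A, by omega⟩
        simpa [Nat.add_sub_cancel' h1] using this
      · have := hB c hc c' hc' (m - 1 - j) (by omega)
        rwa [pad_rev _ (by omega), pad_rev _ (by omega),
          show m - 1 - (m - 1 - j) = j by omega] at this
  have := Finset.card_le_card_of_injOn (t := Finset.univ) _ (fun _ _ => Finset.mem_univ _) hinj
  simpa using this

theorem succ_mul_four_pow_le (k j : ℕ) (h : j ≤ k) : (k + 1 - j) * 4 ^ j ≤ 4 ^ k := by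
  obtain ⟨d, rfl⟩ := Nat.exists_eq_add_of_le h
  rw [show j + d + 1 - j = d + 1 by omega, pow_add, mul_comm]
  exact Nat.mul_le_mul_left _ (Nat.lt_pow_self (by norm_num))

/-- The count of the pairs `(c, i)` whose flipped expansions lie in a fixed dyadic rectangle of
measure `2 ^ (-(A + B))` that also contains one of the unflipped expansions. -/
theorem card_pairs_le {k M A B : ℕ} (hM : M = 4 ^ k)
    (P : Finset (Fin (M + k) → Bool)) (Z : Finset ((Fin (M + k) → Bool) × Fin M))
    (hP : P.Nonempty)
    (hPZ : ∀ c' ∈ P, ∀ z ∈ Z, (∀ i < A, pad c' i = flipFrom (k + z.2) (pad z.1) i) ∧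
      ∀ i < B, pad (c' ∘ Fin.rev) i = flipFrom (M + k - z.2) (pad (z.1 ∘ Fin.rev)) i)
    (hZ : ∀ z ∈ Z, ∀ z' ∈ Z,
      (∀ i < A, flipFrom (k + z.2) (pad z.1) i = flipFrom (k + z'.2) (pad z'.1) i) ∧
      ∀ i < B, flipFrom (M + k - z.2) (pad (z.1 ∘ Fin.rev)) i =
        flipFrom (M + k - z'.2) (pad (z'.1 ∘ Fin.rev)) i) :
    2 ^ (M + k - (A + B)) * Z.card * 4 ^ (A + B) ≤ 4 ^ (M + k) * M := by
  classical
  rcases le_or_gt (A + B) (M + k) with hle | hlt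
  -- Large rectangles: for fixed `i` the flip preserves agreement, so the words `c` are counted as
  -- for the source points.
  · have hZc : Z.card ≤ M * 2 ^ (M + k - (A + B)) := by
      rw [Finset.card_eq_sum_card_fiberwise (f := Prod.snd) (t := Finset.univ)
        (fun _ _ => Finset.mem_univ _)]
      refine (Finset.sum_le_card_nsmul _ _ (2 ^ (M + k - (A + B))) fun i _ => ?_).trans (by simp)
      rw [← Finset.card_image_of_injOn (f := Prod.fst)]
      · refine card_le_of_agree _ ?_ ?_
        · simp only [Finset.mem_image, Finset.mem_filter]
          rintro _ ⟨z, ⟨hz, rfl⟩, rfl⟩ _ ⟨z', ⟨hz', h⟩, rfl⟩ j hj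
          have := (hZ z hz z' hz').1 j hj
          rwa [h, flipFrom_eq_flipFrom] at this
        · simp only [Finset.mem_image, Finset.mem_filter]
          rintro _ ⟨z, ⟨hz, rfl⟩, rfl⟩ _ ⟨z', ⟨hz', h⟩, rfl⟩ j hj
          have := (hZ z hz z' hz').2 j hj
          rwa [h, flipFrom_eq_flipFrom] at this
      · rintro ⟨c, j⟩ hz ⟨c', j'⟩ hz' h
        simp at hz hz' h
        simp [h, hz.2, hz'.2]
    obtain ⟨d, hd⟩ := Nat.exists_eq_add_of_le hle
    have h4 : 4 ^ (M + k) = 4 ^ (A + B + d) := by rw [hd]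
    rw [show M + k - (A + B) = d by omega] at hZc ⊢
    rw [h4]
    calc 2 ^ d * Z.card * 4 ^ (A + B) ≤ 2 ^ d * (M * 2 ^ d) * 4 ^ (A + B) := by gcongr
      _ = 4 ^ (A + B + d) * M := by
        rw [pow_add 4 (A + B) d, show (4 : ℕ) ^ d = 2 ^ d * 2 ^ d by rw [← mul_pow]; norm_num]
        ring
  · obtain ⟨c, hc⟩ := hP
    -- Small rectangles: by separation, every target present belongs to the one source present, and
    -- only the flipping place `i` varies.
    have hzc : ∀ z ∈ Z, c = z.1 := by
      intro z hz
      by_contra hne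
      have := add_le_of_agree hne (a := k + z.2) (b := M + k - z.2) (k := k) (by omega) (by omega)
        (by omega) (hPZ c hc z hz).1 (hPZ c hc z hz).2
      omega
    have hzi : ∀ z ∈ Z, A ≤ k + z.2 ∧ B ≤ M + k - z.2 := by
      intro z hz
      obtain ⟨h1, h2⟩ := hPZ c hc z hz
      rw [hzc z hz] at h1 h2
      exact ⟨le_of_flipFrom_agree h1, le_of_flipFrom_agree h2⟩
    rcases Z.eq_empty_or_nonempty with rfl | ⟨z₀, hz₀⟩
    · simp
    have hj : A + B ≤ M + k + k := by
      have := hzi z₀ hz₀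
      omega
    have hZc : Z.card ≤ k + 1 - (A + B - (M + k)) := by
      have hinj : Set.InjOn (fun z : (Fin (M + k) → Bool) × Fin M => k + (z.2 : ℕ)) Z := by
        intro z hz z' hz' h
        refine Prod.ext ((hzc z hz).symm.trans (hzc z' hz')) (Fin.ext ?_)
        simpa using h
      have := Finset.card_le_card_of_injOn (t := Finset.Icc A (M + k + k - B)) _
        (fun z hz => ?_) hinj
      · rw [Nat.card_Icc] at this
        omega
      · have := hzi z hz
        simp only [Finset.coe_Icc, Set.mem_Icc]
        omega
    obtain ⟨j, hj'⟩ := Nat.exists_eq_add_of_le hlt.le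
    have h4 : 4 ^ (A + B) = 4 ^ (M + k) * 4 ^ j := by rw [hj', pow_add]
    rw [show A + B - (M + k) = j by omega] at hZc
    rw [show M + k - (A + B) = 0 by omega, pow_zero, one_mul, h4]
    -- With `j = A + B - (M + k)`, the factor `k + 1 - j` counts the flipping places and `4 ^ j` is
    -- the growth of the two averages. Their product is at most `4 ^ k`, which dictates the choice
    -- of `M`.
    calc Z.card * (4 ^ (M + k) * 4 ^ j) = 4 ^ (M + k) * (Z.card * 4 ^ j) := by ring
      _ ≤ 4 ^ (M + k) * ((k + 1 - j) * 4 ^ j) := by gcongr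
      _ ≤ 4 ^ (M + k) * 4 ^ k := by gcongr; exact succ_mul_four_pow_le k j (by omega)
      _ = _ := by rw [← hM]

/-- No dyadic rectangle of measure below `2 ^ (-(m + k))` contains expansions of both families. -/
theorem add_le_of_agree' {k M A B : ℕ} {c' : Fin (M + k) → Bool}
    {z : (Fin (M + k) → Bool) × Fin M}
    (hA : ∀ i < A, pad c' i = flipFrom (k + z.2) (pad z.1) i)
    (hB : ∀ i < B, pad (c' ∘ Fin.rev) i = flipFrom (M + k - z.2) (pad (z.1 ∘ Fin.rev)) i) :
    A + B ≤ M + k + k := by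
  by_cases h : c' = z.1
  · subst h
    have h1 := le_of_flipFrom_agree hA
    have h2 := le_of_flipFrom_agree hB
    omega
  · have := add_le_of_agree h (a := k + z.2) (b := M + k - z.2) (k := k) (by omega) (by omega)
        (by omega) hA hB
    omega

/-! ### A weight that controls sparse sums -/

/-- The weight of a dyadic level. -/
noncomputable def levelWeight (n : ℤ) : ℝ := (1 + n.toNat) / 4 ^ n.toNat

theorem levelWeight_pos (n : ℤ) : 0 < levelWeight n := by
  unfold levelWeight
  positivity

/-- The dyadic interval of length `2ⁿ` that contains `s`. -/
noncomputable def ancestor (s : ℤ) (n : ℕ) : DyadicInterval :=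
  (DyadicInterval.exists_mem n (s : ℝ)).choose

theorem ancestor_fst (s : ℤ) (n : ℕ) : (ancestor s n).1 = n :=
  (DyadicInterval.exists_mem n (s : ℝ)).choose_spec.1

theorem mem_ancestor (s : ℤ) (n : ℕ) : (s : ℝ) ∈ (ancestor s n).toSet :=
  (DyadicInterval.exists_mem n (s : ℝ)).choose_spec.2

/-- An integrable function on the line that is at least `levelWeight n` on every dyadic interval of
length `2ⁿ` that meets `[s, s + 1)`. -/
noncomputable def lineWeight (s : ℤ) (t : ℝ) : ℝ≥0∞ :=
  ∑' n : ℕ, (ancestor s n).toSet.indicator (fun _ => ENNReal.ofReal (levelWeight n)) t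

theorem measurable_lineWeight (s : ℤ) : Measurable (lineWeight s) :=
  Measurable.tsum fun n =>
    measurable_const.indicator (ancestor s n).measurableSet_toSet

/-- An interval of length at least 1 that meets `[s, s + 1)` is the ancestor at its level. A shorter
one lies inside `[s, s + 1)` and has level weight 1, because `toNat` sends negative levels to 0. -/
theorem le_lineWeight {s : ℤ} {d : ℕ → Bool} {I : DyadicInterval} {x t : ℝ}
    (hx : x ∈ I.toSet) (hd : x ∈ (cell s d 0).toSet) (ht : t ∈ I.toSet) :
    ENNReal.ofReal (levelWeight I.1) ≤ lineWeight s t := by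
  have hs : (s : ℝ) ∈ (cell s d 0).toSet := by
    simp [DyadicInterval.mem_toSet, cell, prefixCode]
  have hc : cell s d 0 = ancestor s 0 :=
    DyadicInterval.eq_of_mem (by simp [ancestor_fst, cell]) hs (mem_ancestor s 0)
  have key : t ∈ (ancestor s I.1.toNat).toSet := by
    rcases le_or_gt 0 I.1 with h | h
    · have hsub : (cell s d 0).toSet ⊆ I.toSet :=
        DyadicInterval.subset_of_mem (by simpa [cell] using h) hd hx
      rwa [← DyadicInterval.eq_of_mem (I := I) (by rw [ancestor_fst]; omega) (hsub hs)
        (mem_ancestor s I.1.toNat)]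
    · rw [show I.1.toNat = 0 by omega, ← hc]
      exact DyadicInterval.subset_of_mem (by simpa [cell] using h.le) hx hd ht
  refine le_trans ?_ (ENNReal.le_tsum I.1.toNat)
  rw [Set.indicator_of_mem key]
  rw [levelWeight, levelWeight, Int.toNat_natCast]

/-- The integral of `lineWeight s`. -/
noncomputable def weightMass : ℝ≥0∞ := ∑' n : ℕ, ENNReal.ofReal ((1 + n) / 2 ^ n)

theorem lintegral_lineWeight (s : ℤ) : ∫⁻ t, lineWeight s t = weightMass := by
  unfold lineWeight
  rw [lintegral_tsum fun n =>
    (measurable_const.indicator (ancestor s n).measurableSet_toSet).aemeasurable, weightMass]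
  congr 1
  ext n
  rw [lintegral_indicator_const (ancestor s n).measurableSet_toSet, DyadicInterval.volume_toSet,
    ancestor_fst, ← ENNReal.ofReal_mul (levelWeight_pos _).le]
  congr 1
  simp only [levelWeight, Int.toNat_natCast, zpow_natCast]
  rw [show (4 : ℝ) ^ n = 2 ^ n * 2 ^ n by rw [← mul_pow]; norm_num]
  field_simp

theorem weightMass_ne_top : weightMass ≠ ∞ := by
  have h1 : Summable fun n : ℕ => (1 / 2 : ℝ) ^ n := summable_geometric_two
  have h2 : Summable fun n : ℕ => (n : ℝ) ^ 1 * (1 / 2 : ℝ) ^ n :=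
    summable_pow_mul_geometric_of_norm_lt_one 1 (by norm_num)
  have h3 : Summable fun n : ℕ => ((1 + n) / 2 ^ n : ℝ) := by
    refine (h1.add h2).congr fun n => ?_
    rw [one_div_pow]
    field_simp
  exact h3.tsum_ofReal_ne_top

/-- Sparse sums of lower bounds of a function are controlled by its integral. -/
theorem IsSparse.tsum_iInf_mul_volume_le {η : ℝ} (hη : 0 < η) {S : Set DyadicRect}
    (hS : IsSparse η S) (W : ℝ × ℝ → ℝ≥0∞) :
    ∑' R : S, (⨅ x ∈ R.1.toSet, W x) * volume R.1.toSet ≤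
      (ENNReal.ofReal η)⁻¹ * ∫⁻ x, W x := by
  obtain ⟨E, hE, hd⟩ := hS
  have hη0 : ENNReal.ofReal η ≠ 0 := by simpa using hη
  have h1 : ∀ R : S, (⨅ x ∈ R.1.toSet, W x) * volume R.1.toSet ≤
      (ENNReal.ofReal η)⁻¹ * ∫⁻ x in E R, W x := by
    intro R
    obtain ⟨hm, hsub, hv⟩ := hE R.1 R.2
    calc (⨅ x ∈ R.1.toSet, W x) * volume R.1.toSet
        = (ENNReal.ofReal η)⁻¹ *
          ((⨅ x ∈ R.1.toSet, W x) * (ENNReal.ofReal η * volume R.1.toSet)) := by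
          rw [mul_left_comm _ (ENNReal.ofReal η), ← mul_assoc,
            ENNReal.inv_mul_cancel hη0 ENNReal.ofReal_ne_top, one_mul]
      _ ≤ (ENNReal.ofReal η)⁻¹ * ((⨅ x ∈ R.1.toSet, W x) * volume (E R)) := by gcongr
      _ = (ENNReal.ofReal η)⁻¹ * ∫⁻ _ in E R, (⨅ x ∈ R.1.toSet, W x) := by
          rw [setLIntegral_const]
      _ ≤ _ := by
          gcongr 1
          exact setLIntegral_mono' hm fun x hx => iInf₂_le x (hsub hx)
  calc _ ≤ ∑' R : S, (ENNReal.ofReal η)⁻¹ * ∫⁻ x in E R, W x := ENNReal.tsum_le_tsum h1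
    _ = (ENNReal.ofReal η)⁻¹ * ∫⁻ x in ⋃ R : S, E R, W x := by
        rw [ENNReal.tsum_mul_left, lintegral_iUnion (s := fun R : S => E R.1) (fun R => (hE R.1 R.2).1)]
        intro R R' hne
        exact hd R.2 R'.2 (by simpa [Subtype.ext_iff] using hne)
    _ ≤ _ := by
        gcongr 1
        exact setLIntegral_le_lintegral _ _

theorem lintegral_lineWeight_mul (s t : ℤ) :
    ∫⁻ x : ℝ × ℝ, lineWeight s x.1 * lineWeight t x.2 = weightMass * weightMass := by
  rw [Measure.volume_eq_prod, lintegral_prod_mul (measurable_lineWeight s).aemeasurable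
    (measurable_lineWeight t).aemeasurable, lintegral_lineWeight, lintegral_lineWeight]

/-! ### Sums of indicator functions -/

/-- The function `v ∑ᵢ 1_{Qᵢ}`. -/
noncomputable def bumpSum {ι : Type*} [Fintype ι] (Q : ι → DyadicRect) (v : ℝ) (x : ℝ × ℝ) : ℝ :=
  v * ∑ i, (Q i).toSet.indicator 1 x

section BumpSum

variable {ι : Type*} [Fintype ι] {Q : ι → DyadicRect} {v : ℝ}

theorem bumpSum_nonneg (hv : 0 ≤ v) (x : ℝ × ℝ) : 0 ≤ bumpSum Q v x :=
  mul_nonneg hv (Finset.sum_nonneg fun _ _ => Set.indicator_nonneg (fun _ _ => zero_le_one) _)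

theorem bumpSum_le (hv : 0 ≤ v) (x : ℝ × ℝ) : bumpSum Q v x ≤ v * Fintype.card ι := by
  refine mul_le_mul_of_nonneg_left ?_ hv
  refine (Finset.sum_le_card_nsmul _ _ 1 fun i _ => ?_).trans (by simp)
  exact Set.indicator_le_self' (fun _ _ => zero_le_one) x

theorem abs_bumpSum_le (hv : 0 ≤ v) (x : ℝ × ℝ) : |bumpSum Q v x| ≤ v * Fintype.card ι := by
  rw [abs_of_nonneg (bumpSum_nonneg hv x)]
  exact bumpSum_le hv x

theorem bumpSum_eq_zero {x : ℝ × ℝ} (h : ∀ i, x ∉ (Q i).toSet) : bumpSum Q v x = 0 := by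
  simp [bumpSum, h]

theorem measurable_bumpSum : Measurable (bumpSum Q v) :=
  (Finset.measurable_sum _ fun i _ =>
    measurable_one.indicator (Q i).measurableSet_toSet).const_mul v

theorem isTestFunction_bumpSum (hv : 0 ≤ v) : IsTestFunction (bumpSum Q v) where
  measurable := measurable_bumpSum
  bounded := ⟨_, abs_bumpSum_le hv⟩
  hasCompactSupport := by
    have hsub : Function.support (bumpSum Q v) ⊆ ⋃ i, (Q i).toSet := by
      intro x hx
      by_contra h
      exact hx (bumpSum_eq_zero (by simpa using h))
    have hb : Bornology.IsBounded (⋃ i, (Q i).toSet) :=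
      Bornology.isBounded_iUnion.2 fun i =>
        (Metric.isBounded_Ico _ _).prod (Metric.isBounded_Ico _ _)
    exact (hb.subset hsub).isCompact_closure

theorem setLIntegral_bumpSum_le (hv : 0 ≤ v) {q : ℝ}
    (hQ : ∀ i, volume (Q i).toSet = ENNReal.ofReal q) (R : DyadicRect) (S : Finset ι)
    (hS : ∀ i x, x ∈ R.toSet → x ∈ (Q i).toSet → i ∈ S) :
    ∫⁻ x in R.toSet, ENNReal.ofReal |bumpSum Q v x| ≤ ENNReal.ofReal (v * q * S.card) := by
  have h1 : ∀ x, ENNReal.ofReal |bumpSum Q v x| =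
      ENNReal.ofReal v * ∑ i, (Q i).toSet.indicator 1 x := by
    intro x
    rw [abs_of_nonneg (bumpSum_nonneg hv x), bumpSum, ENNReal.ofReal_mul hv,
      ENNReal.ofReal_sum_of_nonneg (f := fun i => (Q i).toSet.indicator 1 x)
        fun _ _ => Set.indicator_nonneg (fun _ _ => zero_le_one) _]
    congr 2
    ext i
    by_cases hx : x ∈ (Q i).toSet <;> simp [hx]
  simp only [h1]
  rw [lintegral_const_mul' _ _ ENNReal.ofReal_ne_top, lintegral_finsetSum _ fun i _ =>
    measurable_one.indicator (Q i).measurableSet_toSet]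
  simp only [lintegral_indicator_one (Q _).measurableSet_toSet,
    Measure.restrict_apply (Q _).measurableSet_toSet]
  rw [mul_assoc, ENNReal.ofReal_mul hv]
  gcongr
  rw [← Finset.sum_subset S.subset_univ]
  · refine (Finset.sum_le_card_nsmul _ _ (ENNReal.ofReal q) fun i _ => ?_).trans ?_
    · rw [← hQ i]
      exact measure_mono Set.inter_subset_left
    · rw [mul_comm, ENNReal.ofReal_mul (by positivity)]
      simp
  · intro i _ hi
    rw [show (Q i).toSet ∩ R.toSet = ∅ from Set.eq_empty_of_forall_notMem
      fun x hx => hi (hS i x hx.2 hx.1), measure_empty]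

end BumpSum

/-! ### Orlicz averages -/

theorem orliczAverage_eq_zero {φ : ℝ → ℝ} (hφ : φ 0 = 0) {f : ℝ × ℝ → ℝ} {R : DyadicRect}
    (hf : ∀ x ∈ R.toSet, f x = 0) : orliczAverage φ f R = 0 := by
  have h : ∀ t : ℝ, 0 < t → orliczAverage φ f R ≤ ENNReal.ofReal t := by
    intro t ht
    refine sInf_le ⟨t, ht, rfl, ?_⟩
    rw [setLIntegral_congr_fun (g := fun _ => 0) R.measurableSet_toSet
      fun x hx => by simp [hf x hx, hφ]]
    simp
  refine le_antisymm (ENNReal.le_of_forall_pos_le_add fun ε hε _ => ?_) zero_le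
  simpa using h ε hε

/-- At the scale `t = A * L` the logarithmic factor is at most `L` everywhere, so the Orlicz
condition reduces to the bound `A` on the ordinary average. -/
theorem orliczAverage_mul_log_le {α : ℝ} (hα : 0 ≤ α) {f : ℝ × ℝ → ℝ} {R : DyadicRect}
    {F A L : ℝ} (hA : 0 < A) (hL : 0 < L) (hF : ∀ x, |f x| ≤ F)
    (hf : ∫⁻ x in R.toSet, ENNReal.ofReal |f x| ≤ ENNReal.ofReal A * volume R.toSet)
    (hlog : (Real.log (Real.exp 1 + F / (A * L))) ^ α ≤ L) :
    orliczAverage (fun x => x * (Real.log (Real.exp 1 + x)) ^ α) f R ≤ ENNReal.ofReal (A * L) := by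
  have ht : 0 < A * L := mul_pos hA hL
  refine sInf_le ⟨A * L, ht, rfl, ENNReal.div_le_of_le_mul ?_⟩
  have hpt : ∀ x, ENNReal.ofReal (|f x| / (A * L) *
      (Real.log (Real.exp 1 + |f x| / (A * L))) ^ α) ≤
      ENNReal.ofReal A⁻¹ * ENNReal.ofReal |f x| := by
    intro x
    rw [← ENNReal.ofReal_mul (by positivity)]
    refine ENNReal.ofReal_le_ofReal ?_
    have h0 : 0 ≤ |f x| / (A * L) := by positivity
    have h1 : 1 ≤ Real.exp 1 + |f x| / (A * L) := by
      have := Real.add_one_le_exp 1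
      linarith
    have h2 : (Real.log (Real.exp 1 + |f x| / (A * L))) ^ α ≤ L := by
      refine le_trans (Real.rpow_le_rpow (Real.log_nonneg h1) ?_ hα) hlog
      refine Real.log_le_log (by linarith) ?_
      gcongr
      exact hF x
    calc _ ≤ |f x| / (A * L) * L := by gcongr
      _ = A⁻¹ * |f x| := by field_simp
  calc _ ≤ ∫⁻ x in R.toSet, ENNReal.ofReal A⁻¹ * ENNReal.ofReal |f x| := lintegral_mono hpt
    _ = ENNReal.ofReal A⁻¹ * ∫⁻ x in R.toSet, ENNReal.ofReal |f x| :=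
        lintegral_const_mul' _ _ ENNReal.ofReal_ne_top
    _ ≤ ENNReal.ofReal A⁻¹ * (ENNReal.ofReal A * volume R.toSet) := by gcongr
    _ = 1 * volume R.toSet := by
        rw [← mul_assoc, ← ENNReal.ofReal_mul (by positivity), inv_mul_cancel₀ hA.ne',
          ENNReal.ofReal_one]

theorem log_exp_one_add_two_pow_le (q : ℕ) : Real.log (Real.exp 1 + 2 ^ q) ≤ q + 2 := by
  have h1 : (1 : ℝ) ≤ 2 ^ q := one_le_pow₀ (by norm_num)
  have h2 : Real.exp 1 ≤ 3 := (Real.exp_one_lt_d9.trans (by norm_num)).le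
  have h3 : Real.log 2 ≤ 1 := (Real.log_two_lt_d9.trans (by norm_num)).le
  calc Real.log (Real.exp 1 + 2 ^ q) ≤ Real.log (2 ^ (q + 2)) :=
        Real.log_le_log (by positivity) (by rw [pow_add]; linarith)
    _ = (q + 2 : ℕ) * Real.log 2 := Real.log_pow _ _
    _ ≤ (q + 2 : ℕ) * 1 := by gcongr
    _ = q + 2 := by push_cast; ring

/-! ### The extremal pair of functions -/

/-- The number of binary digits used in the construction. -/
def depth (k M : ℕ) : ℕ := M + k + k + 1

/-- The small square at the point with the digits `c`, and the reversed digits, in the unit square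
with the lower left corner `(s, 0)`. -/
def sourceSquare (s : ℤ) (k M : ℕ) (c : Fin (M + k) → Bool) : DyadicRect :=
  (cell s (pad c) (depth k M), cell 0 (pad (c ∘ Fin.rev)) (depth k M))

/-- The small square at the point whose digits are flipped from the places `k + i` and
`M + k - i` on. -/
def targetSquare (s : ℤ) (k M : ℕ) (z : (Fin (M + k) → Bool) × Fin M) : DyadicRect :=
  (cell s (flipFrom (k + z.2) (pad z.1)) (depth k M),
    cell 0 (flipFrom (M + k - z.2) (pad (z.1 ∘ Fin.rev))) (depth k M))

/-- Unit mass, evenly distributed over the source squares. -/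
noncomputable def sourceFun (s : ℤ) (k M : ℕ) : ℝ × ℝ → ℝ :=
  bumpSum (sourceSquare s k M) (4 ^ depth k M / 2 ^ (M + k))

/-- Unit mass, evenly distributed over the target squares. -/
noncomputable def targetFun (s : ℤ) (k M : ℕ) : ℝ × ℝ → ℝ :=
  bumpSum (targetSquare s k M) (4 ^ depth k M / (2 ^ (M + k) * M))

theorem volume_cell_prod (s t : ℤ) (d d' : ℕ → Bool) (a b : ℕ) :
    volume (DyadicRect.toSet (cell s d a, cell t d' b)) =
      ENNReal.ofReal ((2 ^ a * 2 ^ b)⁻¹) := by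
  rw [DyadicRect.volume_toSet]
  simp [cell, mul_comm]

theorem volume_cell_square (s t : ℤ) (d d' : ℕ → Bool) (n : ℕ) :
    volume (DyadicRect.toSet (cell s d n, cell t d' n)) = ENNReal.ofReal ((4 ^ n)⁻¹) := by
  rw [volume_cell_prod, ← mul_pow]
  norm_num

theorem two_zpow_eq_div (n : ℤ) : (2 : ℝ) ^ n = 2 ^ n.toNat / 2 ^ (-n).toNat := by
  rw [eq_div_iff (by positivity), ← zpow_natCast, ← zpow_natCast, ← zpow_add₀ (by norm_num)]
  congr 1
  omega

theorem sourceFun_value_nonneg (k M : ℕ) : (0 : ℝ) ≤ 4 ^ depth k M / 2 ^ (M + k) := by positivity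

theorem targetFun_value_nonneg (k M : ℕ) : (0 : ℝ) ≤ 4 ^ depth k M / (2 ^ (M + k) * M) := by
  positivity

theorem abs_sourceFun_le (s : ℤ) (k M : ℕ) (x : ℝ × ℝ) : |sourceFun s k M x| ≤ 4 ^ depth k M := by
  refine (abs_bumpSum_le (sourceFun_value_nonneg k M) x).trans_eq ?_
  simp

/-- The logarithmic loss is only polynomial in the depth. -/
theorem log_rpow_le {α : ℝ} (hα₀ : 0 ≤ α) (hα₁ : α ≤ 1) {N a b : ℕ} (hN : 1 ≤ N) {y : ℝ}
    (hy₀ : 0 ≤ y) (hy : y ≤ 4 ^ N * (2 ^ a * 2 ^ b)) :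
    (Real.log (Real.exp 1 + y)) ^ α ≤ (5 * N : ℝ) ^ α * ((1 + a) * (1 + b)) := by
  have hN' : (1 : ℝ) ≤ N := by exact_mod_cast hN
  have ha : (0 : ℝ) ≤ a := by positivity
  have hb : (0 : ℝ) ≤ b := by positivity
  have h1 : 1 ≤ Real.exp 1 := by
    have := Real.add_one_le_exp 1
    linarith
  have h2 : Real.log (Real.exp 1 + y) ≤ 5 * N * ((1 + a) * (1 + b)) := by
    have hy' : y ≤ 2 ^ (2 * N + a + b) := by
      refine hy.trans_eq ?_
      rw [pow_add, pow_add, pow_mul]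
      norm_num
      ring
    calc Real.log (Real.exp 1 + y) ≤ Real.log (Real.exp 1 + 2 ^ (2 * N + a + b)) :=
          Real.log_le_log (by positivity) (by gcongr)
      _ ≤ (2 * N + a + b : ℕ) + 2 := log_exp_one_add_two_pow_le _
      _ = 2 * N + a + b + 2 := by push_cast; ring
      _ ≤ _ := by nlinarith [mul_nonneg ha hb, mul_nonneg (mul_nonneg ha hb) (by linarith : (0:ℝ) ≤ N),
          mul_nonneg ha (by linarith : (0:ℝ) ≤ N - 1), mul_nonneg hb (by linarith : (0:ℝ) ≤ N - 1)]
  calc (Real.log (Real.exp 1 + y)) ^ α ≤ (5 * N * ((1 + a) * (1 + b))) ^ α :=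
        Real.rpow_le_rpow (Real.log_nonneg (by linarith)) h2 hα₀
    _ = (5 * N : ℝ) ^ α * ((1 + a) * (1 + b)) ^ α := Real.mul_rpow (by positivity) (by positivity)
    _ ≤ (5 * N : ℝ) ^ α * ((1 + a) * (1 + b)) := by
        gcongr
        exact Real.rpow_le_self_of_one_le (by nlinarith) hα₁

/-- With `a`, `b` the positive and `-A`, `-B` the negative parts of the levels of the sides,
`card_pairs_le` bounds the product of the two ordinary averages by `4 ^ (-(a + b))`. The Orlicz loss
is `(5 * depth) ^ α` times `(1 + a) * (1 + b)`, and the last factors are exactly those built into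
`levelWeight`. -/
theorem sparse_term_le {α : ℝ} (hα₀ : 0 ≤ α) (hα₁ : α ≤ 1) (s : ℤ) {k M : ℕ} (hM : M = 4 ^ k)
    (R : DyadicRect) :
    orliczAverage (fun x => x * (Real.log (Real.exp 1 + x)) ^ α) (sourceFun s k M) R *
        rectAverage (targetFun s k M) R * volume R.toSet ≤
      ENNReal.ofReal ((5 * depth k M : ℝ) ^ α) *
        ((⨅ x ∈ R.toSet, lineWeight s x.1 * lineWeight 0 x.2) * volume R.toSet) := by
  classical
  set N := depth k M with hN
  set P : Finset (Fin (M + k) → Bool) :=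
    {c | ∃ x ∈ R.toSet, x ∈ (sourceSquare s k M c).toSet} with hPdef
  set Z : Finset ((Fin (M + k) → Bool) × Fin M) :=
    {z | ∃ x ∈ R.toSet, x ∈ (targetSquare s k M z).toSet} with hZdef
  have hMpos : 0 < M := by rw [hM]; positivity
  have hg : rectAverage (targetFun s k M) R * volume R.toSet ≤
      ENNReal.ofReal (Z.card / (2 ^ (M + k) * M)) := by
    rw [rectAverage, ENNReal.div_mul_cancel R.volume_ne_zero R.volume_ne_top]
    refine (setLIntegral_bumpSum_le (targetFun_value_nonneg k M)
      (fun i => volume_cell_square _ _ _ _ _) R Z ?_).trans_eq ?_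
    · intro i x h1 h2
      simp only [hZdef, Finset.mem_filter, Finset.mem_univ, true_and]
      exact ⟨x, h1, h2⟩
    · congr 1
      field_simp
  -- A rectangle that misses either family contributes nothing.
  rcases P.eq_empty_or_nonempty with hP | hP
  · rw [orliczAverage_eq_zero (by simp)]
    · simp
    · intro x hx
      refine bumpSum_eq_zero fun c hc => ?_
      have : c ∈ P := by
        simp only [hPdef, Finset.mem_filter, Finset.mem_univ, true_and]
        exact ⟨x, hx, hc⟩
      simp [hP] at this
  rcases Z.eq_empty_or_nonempty with hZ | hZ
  · rw [mul_assoc]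
    refine (mul_le_mul_right hg _).trans ?_
    simp [hZ]
  have hPZ : ∀ c' ∈ P, ∀ z ∈ Z,
      (∀ i < min (-R.1.1).toNat N, pad c' i = flipFrom (k + z.2) (pad z.1) i) ∧
      ∀ i < min (-R.2.1).toNat N,
        pad (c' ∘ Fin.rev) i = flipFrom (M + k - z.2) (pad (z.1 ∘ Fin.rev)) i := by
    intro c hc z hz
    simp only [hPdef, hZdef, Finset.mem_filter, Finset.mem_univ, true_and] at hc hz
    obtain ⟨x, hx, hx'⟩ := hc
    obtain ⟨y, hy, hy'⟩ := hz
    exact ⟨agree_of_mem hx.1 hx'.1 hy.1 hy'.1, agree_of_mem hx.2 hx'.2 hy.2 hy'.2⟩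
  have hZZ : ∀ z ∈ Z, ∀ z' ∈ Z,
      (∀ i < min (-R.1.1).toNat N,
        flipFrom (k + z.2) (pad z.1) i = flipFrom (k + z'.2) (pad z'.1) i) ∧
      ∀ i < min (-R.2.1).toNat N, flipFrom (M + k - z.2) (pad (z.1 ∘ Fin.rev)) i =
        flipFrom (M + k - z'.2) (pad (z'.1 ∘ Fin.rev)) i := by
    intro c hc z hz
    simp only [hZdef, Finset.mem_filter, Finset.mem_univ, true_and] at hc hz
    obtain ⟨x, hx, hx'⟩ := hc
    obtain ⟨y, hy, hy'⟩ := hz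
    exact ⟨agree_of_mem hx.1 hx'.1 hy.1 hy'.1, agree_of_mem hx.2 hx'.2 hy.2 hy'.2⟩
  have hPP : ∀ c ∈ P, ∀ c' ∈ P, (∀ i < min (-R.1.1).toNat N, pad c i = pad c' i) ∧
      ∀ i < min (-R.2.1).toNat N, pad (c ∘ Fin.rev) i = pad (c' ∘ Fin.rev) i := by
    intro c hc z hz
    simp only [hPdef, Finset.mem_filter, Finset.mem_univ, true_and] at hc hz
    obtain ⟨x, hx, hx'⟩ := hc
    obtain ⟨y, hy, hy'⟩ := hz
    exact ⟨agree_of_mem hx.1 hx'.1 hy.1 hy'.1, agree_of_mem hx.2 hx'.2 hy.2 hy'.2⟩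
  obtain ⟨c₀, hc₀⟩ := hP
  obtain ⟨z₀, hz₀⟩ := hZ
  have hsum := add_le_of_agree' (hPZ c₀ hc₀ z₀ hz₀).1 (hPZ c₀ hc₀ z₀ hz₀).2
  -- Agreement totals at most `M + 2 * k < N`, so the cutoff at the depth of the squares is never
  -- active.
  have hA : min (-R.1.1).toNat N = (-R.1.1).toNat := by
    simp only [hN, depth] at hsum ⊢
    omega
  have hB : min (-R.2.1).toNat N = (-R.2.1).toNat := by
    simp only [hN, depth] at hsum ⊢
    omega
  rw [hA, hB] at hPZ hZZ hPP
  have hcard := card_pairs_le hM P Z ⟨c₀, hc₀⟩ hPZ hZZ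
  have hPcard := card_le_of_agree P (fun c hc c' hc' => (hPP c hc c' hc').1)
    fun c hc c' hc' => (hPP c hc c' hc').2
  have hwt : ENNReal.ofReal (levelWeight R.1.1 * levelWeight R.2.1) ≤
      ⨅ x ∈ R.toSet, lineWeight s x.1 * lineWeight 0 x.2 := by
    simp only [hPdef, Finset.mem_filter, Finset.mem_univ, true_and] at hc₀
    obtain ⟨x, hx, hx'⟩ := hc₀
    refine le_iInf₂ fun y hy => ?_
    rw [ENNReal.ofReal_mul (levelWeight_pos _).le]
    exact mul_le_mul' (le_lineWeight hx.1 (cell_antitone _ _ (Nat.zero_le _) hx'.1) hy.1)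
      (le_lineWeight hx.2 (cell_antitone _ _ (Nat.zero_le _) hx'.2) hy.2)
  have hvol := R.volume_toSet
  rw [two_zpow_eq_div, two_zpow_eq_div] at hvol
  have hw1 : levelWeight R.1.1 = (1 + R.1.1.toNat) / 4 ^ R.1.1.toNat := rfl
  have hw2 : levelWeight R.2.1 = (1 + R.2.1.toNat) / 4 ^ R.2.1.toNat := rfl
  generalize (-R.1.1).toNat = A at *
  generalize (-R.2.1).toNat = B at *
  generalize R.1.1.toNat = a at *
  generalize R.2.1.toNat = b at *
  set r : ℝ := 2 ^ a / 2 ^ A * (2 ^ b / 2 ^ B) with hr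
  have hr0 : 0 < r := by positivity
  set n : ℕ := 2 ^ (M + k - (A + B)) with hn
  -- Only an inequality: truncated subtraction gives `n = 1` once `A + B` exceeds `M + k`.
  have hn1 : (2 : ℝ) ^ (M + k) ≤ n * 2 ^ (A + B) := by
    rw [hn]
    push_cast
    rw [← pow_add]
    exact pow_le_pow_right₀ (by norm_num) (by omega)
  have hn0 : (0 : ℝ) < n := by rw [hn]; positivity
  have hN1 : 1 ≤ N := by simp [hN, depth]
  have hN0 : (0 : ℝ) < N := by exact_mod_cast hN1
  have hNα : (1 : ℝ) ≤ (5 * N : ℝ) ^ α := by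
    refine Real.one_le_rpow ?_ hα₀
    have : (1 : ℝ) ≤ N := by exact_mod_cast hN1
    linarith
  set L : ℝ := (5 * N : ℝ) ^ α * ((1 + a) * (1 + b)) with hL
  have hL1 : 1 ≤ L := by
    have ha : (1 : ℝ) ≤ 1 + a := by simp
    have hb : (1 : ℝ) ≤ 1 + b := by simp
    have := one_le_mul_of_one_le_of_one_le ha hb
    exact one_le_mul_of_one_le_of_one_le hNα this
  have horl : orliczAverage (fun x => x * (Real.log (Real.exp 1 + x)) ^ α) (sourceFun s k M) R ≤
      ENNReal.ofReal (n / (2 ^ (M + k) * r) * L) := by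
    refine orliczAverage_mul_log_le hα₀ (by positivity) (by linarith) (abs_sourceFun_le s k M) ?_ ?_
    · refine (setLIntegral_bumpSum_le (sourceFun_value_nonneg k M)
        (fun i => volume_cell_square _ _ _ _ _) R P ?_).trans ?_
      · intro i x h1 h2
        simp only [hPdef, Finset.mem_filter, Finset.mem_univ, true_and]
        exact ⟨x, h1, h2⟩
      · rw [hvol, ← ENNReal.ofReal_mul (by positivity)]
        refine ENNReal.ofReal_le_ofReal ?_
        have : (P.card : ℝ) ≤ n := by exact_mod_cast hPcard
        calc _ = (P.card : ℝ) / 2 ^ (M + k) := by field_simp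
          _ ≤ n / 2 ^ (M + k) := by gcongr
          _ = _ := by field_simp
    · refine log_rpow_le hα₀ hα₁ hN1 (by positivity) ?_
      rw [← hN]
      calc (4 : ℝ) ^ N / (n / (2 ^ (M + k) * r) * L) ≤ 4 ^ N / (n / (2 ^ (M + k) * r) * 1) := by
            gcongr
        _ = 4 ^ N * (2 ^ (M + k) / n * r) := by field_simp
        _ ≤ 4 ^ N * (2 ^ (A + B) * r) := by
            gcongr
            rw [div_le_iff₀ hn0, mul_comm]
            exact hn1
        _ = _ := by rw [hr, pow_add]; field_simp
  calc _ = orliczAverage (fun x => x * (Real.log (Real.exp 1 + x)) ^ α) (sourceFun s k M) R *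
        (rectAverage (targetFun s k M) R * volume R.toSet) := mul_assoc _ _ _
    _ ≤ ENNReal.ofReal (n / (2 ^ (M + k) * r) * L) *
        ENNReal.ofReal (Z.card / (2 ^ (M + k) * M)) := mul_le_mul' horl hg
    _ ≤ ENNReal.ofReal ((5 * N : ℝ) ^ α) *
        (ENNReal.ofReal (levelWeight R.1.1 * levelWeight R.2.1) * volume R.toSet) := by
        have hc : (n : ℝ) * Z.card * 4 ^ (A + B) ≤ 4 ^ (M + k) * M := by exact_mod_cast hcard
        have hM0 : (0 : ℝ) < M := by exact_mod_cast hMpos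
        rw [hvol, ← ENNReal.ofReal_mul (by positivity),
          ← ENNReal.ofReal_mul (mul_pos (levelWeight_pos _) (levelWeight_pos _)).le,
          ← ENNReal.ofReal_mul (by positivity), hw1, hw2]
        refine ENNReal.ofReal_le_ofReal ?_
        have h4 : ∀ q : ℕ, (4 : ℝ) ^ q = 2 ^ q * 2 ^ q := fun q => by rw [← mul_pow]; norm_num
        have key : (n : ℝ) * Z.card / (4 ^ (M + k) * M) ≤ 1 / 4 ^ (A + B) := by
          rw [div_le_div_iff₀ (by positivity) (by positivity)]
          linarith
        calc _ = L / r * (n * Z.card / (4 ^ (M + k) * M)) := by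
              rw [h4 (M + k)]; field_simp
          _ ≤ L / r * (1 / 4 ^ (A + B)) := by gcongr
          _ = _ := by
              rw [hL, hr, h4, h4, h4, pow_add]
              field_simp
    _ ≤ _ := by gcongr

theorem sparseForm_le {α : ℝ} (hα₀ : 0 ≤ α) (hα₁ : α ≤ 1) (s : ℤ) {k M : ℕ} (hM : M = 4 ^ k)
    {η : ℝ} (hη : 0 < η) {S : Set DyadicRect} (hS : IsSparse η S) :
    sparseForm (fun x => x * (Real.log (Real.exp 1 + x)) ^ α) S (sourceFun s k M)
        (targetFun s k M) ≤
      ENNReal.ofReal ((5 * depth k M : ℝ) ^ α) *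
        ((ENNReal.ofReal η)⁻¹ * (weightMass * weightMass)) := by
  refine (ENNReal.tsum_le_tsum fun R : S => sparse_term_le hα₀ hα₁ s hM R.1).trans ?_
  rw [ENNReal.tsum_mul_left, ← lintegral_lineWeight_mul s 0]
  gcongr
  exact hS.tsum_iInf_mul_volume_le hη _

/-! ### The rectangles that link the two families -/

/-- The smallest dyadic rectangle that contains the target square of `z` and its source square. -/
def linkRect (s : ℤ) (k M : ℕ) (z : (Fin (M + k) → Bool) × Fin M) : DyadicRect :=
  (cell s (pad z.1) (k + z.2), cell 0 (pad (z.1 ∘ Fin.rev)) (M + k - z.2))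

theorem volume_linkRect (s : ℤ) (k M : ℕ) (z : (Fin (M + k) → Bool) × Fin M) :
    volume (linkRect s k M z).toSet = ENNReal.ofReal ((2 ^ (M + k + k))⁻¹) := by
  have hi := z.2.2
  rw [linkRect, volume_cell_prod, ← pow_add,
    show k + (z.2 : ℕ) + (M + k - z.2) = M + k + k by omega]

theorem cell_flipFrom (s : ℤ) (d : ℕ → Bool) (a : ℕ) : cell s (flipFrom a d) a = cell s d a :=
  cell_inj.2 fun _ hi => flipFrom_of_lt d hi

theorem sourceSquare_subset_linkRect (s : ℤ) (k M : ℕ) (z : (Fin (M + k) → Bool) × Fin M) :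
    (sourceSquare s k M z.1).toSet ⊆ (linkRect s k M z).toSet :=
  Set.prod_mono (cell_antitone _ _ (by have := z.2.2; unfold depth; omega))
    (cell_antitone _ _ (by unfold depth; omega))

theorem targetSquare_subset_linkRect (s : ℤ) (k M : ℕ) (z : (Fin (M + k) → Bool) × Fin M) :
    (targetSquare s k M z).toSet ⊆ (linkRect s k M z).toSet := by
  rw [linkRect, ← cell_flipFrom s, ← cell_flipFrom 0]
  exact Set.prod_mono (cell_antitone _ _ (by have := z.2.2; unfold depth; omega))
    (cell_antitone _ _ (by unfold depth; omega))

theorem agree_of_mem_cell {s : ℤ} {d d' : ℕ → Bool} {a N : ℕ} (h : a ≤ N) {x : ℝ}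
    (hx : x ∈ (cell s d a).toSet) (hx' : x ∈ (cell s d' N).toSet) : ∀ i < a, d i = d' i := by
  rw [← cell_inj (s := s)]
  exact eq_cell_of_mem rfl h hx hx'

/-- The two sides fix the first `k + i` and the last `M + k - i` digits, which cover the whole word.
-/
theorem eq_of_mem_sourceSquare {s : ℤ} {k M : ℕ} {z : (Fin (M + k) → Bool) × Fin M}
    {c : Fin (M + k) → Bool} {x : ℝ × ℝ} (hx : x ∈ (linkRect s k M z).toSet)
    (hc : x ∈ (sourceSquare s k M c).toSet) : c = z.1 := by
  have hi := z.2.2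
  have h1 := agree_of_mem_cell (by unfold depth; omega) hx.1 hc.1
  have h2 := agree_of_mem_cell (by unfold depth; omega) hx.2 hc.2
  refine pad_ext fun j hj => ?_
  by_cases hja : j < k + z.2
  · exact (h1 j hja).symm
  · have := h2 (M + k - 1 - j) (by omega)
    rw [pad_rev _ (by omega), pad_rev _ (by omega),
      show M + k - 1 - (M + k - 1 - j) = j by omega] at this
    exact this.symm

/-- A target of another word is excluded by separation, since the sides fix `M + k + k > M + k`
digits; this needs `k ≥ 1`. For the same word neither flip may start before its side ends, which
forces equal places because the sum of the two places is constant. -/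
theorem eq_of_mem_targetSquare {s : ℤ} {k M : ℕ} (hk : 1 ≤ k)
    {z z' : (Fin (M + k) → Bool) × Fin M} {x : ℝ × ℝ} (hx : x ∈ (linkRect s k M z).toSet)
    (hz' : x ∈ (targetSquare s k M z').toSet) : z' = z := by
  have hi := z.2.2
  have hi' := z'.2.2
  have h1 := agree_of_mem_cell (by unfold depth; omega) hx.1 hz'.1
  have h2 := agree_of_mem_cell (by unfold depth; omega) hx.2 hz'.2
  have hc : z.1 = z'.1 := by
    by_contra hne
    have := add_le_of_agree hne (k := k) (by omega) (by omega) (by omega) h1 h2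
    omega
  rw [hc] at h1 h2
  have h3 := le_of_flipFrom_agree h1
  have h4 := le_of_flipFrom_agree h2
  exact Prod.ext hc.symm (Fin.ext (by omega))

theorem DyadicRect.nonempty_toSet (R : DyadicRect) : R.toSet.Nonempty :=
  nonempty_of_measure_ne_zero R.volume_ne_zero

theorem linkRect_injective (s : ℤ) {k M : ℕ} (hk : 1 ≤ k) :
    Function.Injective (linkRect s k M) := by
  intro z z' h
  obtain ⟨x, hx⟩ := (targetSquare s k M z).nonempty_toSet
  exact eq_of_mem_targetSquare hk (h ▸ targetSquare_subset_linkRect s k M z hx) hx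

/-! ### The strong maximal function -/

theorem rectAverage_le {f : ℝ × ℝ → ℝ} {F : ℝ} (hf : ∀ x, |f x| ≤ F) (R : DyadicRect) :
    rectAverage f R ≤ ENNReal.ofReal F := by
  refine ENNReal.div_le_of_le_mul ?_
  calc _ ≤ ∫⁻ _ in R.toSet, ENNReal.ofReal F :=
        lintegral_mono fun x => ENNReal.ofReal_le_ofReal (hf x)
    _ = _ := setLIntegral_const _ _

theorem iSup_rectAverage_le {f : ℝ × ℝ → ℝ} {F : ℝ} (hf : ∀ x, |f x| ≤ F) (x : ℝ × ℝ) :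
    ⨆ R : DyadicRect, ⨆ _ : x ∈ R.toSet, rectAverage f R ≤ ENNReal.ofReal F :=
  iSup₂_le fun R _ => rectAverage_le hf R

theorem strongMaximal_le {f : ℝ × ℝ → ℝ} {F : ℝ} (hf : ∀ x, |f x| ≤ F) (x : ℝ × ℝ) :
    strongMaximal f x ≤ F :=
  ENNReal.toReal_le_of_le_ofReal ((abs_nonneg _).trans (hf x)) (iSup_rectAverage_le hf x)

theorem measurable_strongMaximal (f : ℝ × ℝ → ℝ) : Measurable (strongMaximal f) := by
  refine Measurable.ennreal_toReal (Measurable.iSup fun R => ?_)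
  have : (fun x : ℝ × ℝ => ⨆ _ : x ∈ R.toSet, rectAverage f R) =
      R.toSet.indicator fun _ => rectAverage f R := by
    ext x
    by_cases h : x ∈ R.toSet <;> simp [h]
  rw [this]
  exact measurable_const.indicator R.measurableSet_toSet

theorem two_pow_le_rectAverage_linkRect (s : ℤ) (k M : ℕ) (z : (Fin (M + k) → Bool) × Fin M) :
    ENNReal.ofReal (2 ^ k) ≤ rectAverage (sourceFun s k M) (linkRect s k M z) := by
  rw [rectAverage, ENNReal.le_div_iff_mul_le (Or.inl (DyadicRect.volume_ne_zero _))
    (Or.inl (DyadicRect.volume_ne_top _)), volume_linkRect]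
  calc ENNReal.ofReal (2 ^ k) * ENNReal.ofReal ((2 ^ (M + k + k))⁻¹)
      = ∫⁻ _ in (sourceSquare s k M z.1).toSet,
          ENNReal.ofReal (4 ^ depth k M / 2 ^ (M + k)) := by
        rw [setLIntegral_const, sourceSquare, volume_cell_square,
          ← ENNReal.ofReal_mul (by positivity), ← ENNReal.ofReal_mul (by positivity)]
        congr 1
        rw [pow_add _ (M + k)]
        field_simp
    _ ≤ ∫⁻ x in (sourceSquare s k M z.1).toSet, ENNReal.ofReal |sourceFun s k M x| := by
        refine setLIntegral_mono' (DyadicRect.measurableSet_toSet _) fun x hx => ?_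
        refine ENNReal.ofReal_le_ofReal (le_trans ?_ (le_abs_self _))
        refine le_mul_of_one_le_right (sourceFun_value_nonneg k M) ?_
        refine le_trans ?_ (Finset.single_le_sum (f := fun c =>
          (sourceSquare s k M c).toSet.indicator (1 : ℝ × ℝ → ℝ) x)
          (fun _ _ => Set.indicator_nonneg (fun _ _ => zero_le_one) _) (Finset.mem_univ z.1))
        simp [hx]
    _ ≤ _ := lintegral_mono_set (sourceSquare_subset_linkRect s k M z)

theorem two_pow_le_strongMaximal {s : ℤ} {k M : ℕ} {z : (Fin (M + k) → Bool) × Fin M} {x : ℝ × ℝ}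
    (hx : x ∈ (targetSquare s k M z).toSet) : 2 ^ k ≤ strongMaximal (sourceFun s k M) x := by
  -- The supremum is finite because the source function is bounded, so `toReal` loses nothing.
  refine (ENNReal.ofReal_le_iff_le_toReal ?_).1
    ((two_pow_le_rectAverage_linkRect s k M z).trans ?_)
  · exact ((iSup_rectAverage_le (abs_sourceFun_le s k M) x).trans_lt ENNReal.ofReal_lt_top).ne
  · exact le_iSup₂_of_le (linkRect s k M z) (targetSquare_subset_linkRect s k M z hx) le_rfl

theorem memLp_bumpSum {ι : Type*} [Fintype ι] (Q : ι → DyadicRect) (v : ℝ) (p : ℝ≥0∞) :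
    MemLp (bumpSum Q v) p (volume : Measure (ℝ × ℝ)) :=
  (memLp_finsetSum _ fun i _ => memLp_indicator_const p (Q i).measurableSet_toSet (1 : ℝ)
    (Or.inr (Q i).volume_ne_top)).const_mul v

theorem integral_targetFun (s : ℤ) {k M : ℕ} (hM : 0 < M) : ∫ x, targetFun s k M x = 1 := by
  have hint : ∀ z ∈ Finset.univ,
      Integrable ((targetSquare s k M z).toSet.indicator (1 : ℝ × ℝ → ℝ)) := fun z _ =>
    memLp_one_iff_integrable.1 (memLp_indicator_const 1 (DyadicRect.measurableSet_toSet _) (1 : ℝ)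
      (Or.inr (DyadicRect.volume_ne_top _)))
  have hval : ∀ z, ∫ x, (targetSquare s k M z).toSet.indicator (1 : ℝ × ℝ → ℝ) x =
      (4 ^ depth k M)⁻¹ := by
    intro z
    rw [integral_indicator_one (DyadicRect.measurableSet_toSet _), measureReal_def,
      targetSquare, volume_cell_square, ENNReal.toReal_ofReal (by positivity)]
  simp only [targetFun, bumpSum]
  rw [integral_const_mul, integral_finsetSum _ hint, Finset.sum_congr rfl fun z _ => hval z]
  simp
  field_simp

theorem two_pow_le_integral_strongMaximal (s : ℤ) {k M : ℕ} (hM : 0 < M) :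
    2 ^ k ≤ ∫ x, strongMaximal (sourceFun s k M) x * targetFun s k M x := by
  have hg : Integrable (targetFun s k M) := memLp_one_iff_integrable.1 (memLp_bumpSum _ _ 1)
  calc (2 : ℝ) ^ k = ∫ x, 2 ^ k * targetFun s k M x := by
        rw [integral_const_mul, integral_targetFun s hM, mul_one]
    _ ≤ _ := by
        refine integral_mono (hg.const_mul _) ?_ fun x => ?_
        · refine hg.bdd_mul (measurable_strongMaximal _).aestronglyMeasurable
            (c := 4 ^ depth k M) (Filter.Eventually.of_forall fun x => ?_)
          rw [Real.norm_of_nonneg (by exact ENNReal.toReal_nonneg)]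
          exact strongMaximal_le (abs_sourceFun_le s k M) x
        · by_cases h : ∃ z, x ∈ (targetSquare s k M z).toSet
          · obtain ⟨z, hz⟩ := h
            exact mul_le_mul_of_nonneg_right (two_pow_le_strongMaximal hz)
              (bumpSum_nonneg (targetFun_value_nonneg k M) x)
          · have : targetFun s k M x = 0 := bumpSum_eq_zero (by simpa using h)
            simp [this]

/-! ### The martingale transform -/

theorem integral_bumpSum_mul_haar {ι : Type*} [Fintype ι] {Q : ι → DyadicRect} {v w : ℝ}
    {R : DyadicRect} {i : ι} (hR : ∀ j x, x ∈ R.toSet → x ∈ (Q j).toSet → j = i)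
    (hw : ∀ x ∈ (Q i).toSet, haar R x = w) :
    ∫ x, bumpSum Q v x * haar R x = v * w * (volume (Q i).toSet).toReal := by
  classical
  have hpt : (fun x => bumpSum Q v x * haar R x) =
      (Q i).toSet.indicator fun _ => v * w := by
    ext x
    by_cases hx : x ∈ R.toSet
    · have : ∑ j, (Q j).toSet.indicator (1 : ℝ × ℝ → ℝ) x = (Q i).toSet.indicator 1 x := by
        refine Finset.sum_eq_single i (fun j _ hj => ?_) (by simp)
        exact Set.indicator_of_notMem (fun h => hj (hR j x hx h)) _
      rw [bumpSum, this]
      by_cases hi : x ∈ (Q i).toSet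
      · simp [hi, hw x hi]
      · simp [hi]
    · rw [haar_eq_zero hx, mul_zero]
      by_cases hi : x ∈ (Q i).toSet
      · rw [Set.indicator_of_mem hi, ← hw x hi, haar_eq_zero hx, mul_zero]
      · rw [Set.indicator_of_notMem hi]
  rw [hpt, integral_indicator_const _ (Q i).measurableSet_toSet, measureReal_def, smul_eq_mul,
    mul_comm]

theorem digitSign_flipFrom (d : ℕ → Bool) (a : ℕ) :
    digitSign (flipFrom a d) a = -digitSign d a := by
  rw [digitSign, digitSign, flipFrom_of_le d le_rfl]
  cases d a <;> simp

theorem digitSign_mul_self (d : ℕ → Bool) (a : ℕ) : digitSign d a * digitSign d a = 1 := by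
  rw [digitSign]
  split_ifs <;> norm_num

/-- The positive factor in the value of the Haar function on the side of a cell. -/
noncomputable def haarScale (a : ℕ) : ℝ := (Real.sqrt ((2 : ℝ) ^ (-(a : ℤ))))⁻¹

theorem haarScale_mul_self (a : ℕ) : haarScale a * haarScale a = 2 ^ a := by
  rw [haarScale, ← mul_inv, Real.mul_self_sqrt (by positivity)]
  simp

theorem haar_linkRect_source {s : ℤ} {k M : ℕ} {z : (Fin (M + k) → Bool) × Fin M} {x : ℝ × ℝ}
    (hx : x ∈ (sourceSquare s k M z.1).toSet) :
    haar (linkRect s k M z) x = haarScale (k + z.2) * digitSign (pad z.1) (k + z.2) *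
      (haarScale (M + k - z.2) * digitSign (pad (z.1 ∘ Fin.rev)) (M + k - z.2)) := by
  have hi := z.2.2
  rw [haar, linkRect, haarInterval_cell (by unfold depth; omega) hx.1,
    haarInterval_cell (by unfold depth; omega) hx.2]
  rfl

/-- Each flip starts exactly at the digit that decides the half of the side, so both signs change
and the product is that of the source square. -/
theorem haar_linkRect_target {s : ℤ} {k M : ℕ} {z : (Fin (M + k) → Bool) × Fin M} {x : ℝ × ℝ}
    (hx : x ∈ (targetSquare s k M z).toSet) :
    haar (linkRect s k M z) x = haarScale (k + z.2) * digitSign (pad z.1) (k + z.2) *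
      (haarScale (M + k - z.2) * digitSign (pad (z.1 ∘ Fin.rev)) (M + k - z.2)) := by
  have hi := z.2.2
  rw [haar, linkRect, ← cell_flipFrom s, ← cell_flipFrom 0 (pad (z.1 ∘ Fin.rev)),
    haarInterval_cell (by unfold depth; omega) hx.1,
    haarInterval_cell (by unfold depth; omega) hx.2, digitSign_flipFrom, digitSign_flipFrom]
  simp only [haarScale]
  ring

theorem integral_source_mul_integral_target (s : ℤ) {k M : ℕ} (hk : 1 ≤ k)
    (z : (Fin (M + k) → Bool) × Fin M) :
    (∫ x, sourceFun s k M x * haar (linkRect s k M z) x) *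
        ∫ x, targetFun s k M x * haar (linkRect s k M z) x =
      2 ^ k / (2 ^ (M + k) * M) := by
  rw [sourceFun, targetFun,
    integral_bumpSum_mul_haar (i := z.1) (fun _ _ h h' => eq_of_mem_sourceSquare h h')
      fun _ h => haar_linkRect_source h,
    integral_bumpSum_mul_haar (i := z) (fun _ _ h h' => eq_of_mem_targetSquare hk h h')
      fun _ h => haar_linkRect_target h, sourceSquare, targetSquare, volume_cell_square,
    volume_cell_square, ENNReal.toReal_ofReal (by positivity)]
  have hi := z.2.2
  have hM : (0 : ℝ) < M := by exact_mod_cast (by omega : 0 < M)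
  set p := haarScale (k + z.2)
  set q := haarScale (M + k - z.2)
  set u := digitSign (pad z.1) (k + z.2)
  set w := digitSign (pad (z.1 ∘ Fin.rev)) (M + k - z.2)
  have hpq : p * p * (q * q) = 2 ^ (M + k) * 2 ^ k := by
    rw [haarScale_mul_self, haarScale_mul_self, ← pow_add, ← pow_add]
    congr 1
    omega
  have hu : u * u = 1 := digitSign_mul_self _ _
  have hw : w * w = 1 := digitSign_mul_self _ _
  calc _ = (p * p * (q * q)) * (u * u) * (w * w) / (2 ^ (M + k) * (2 ^ (M + k) * M)) := by
        field_simp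
    _ = _ := by
        rw [hpq, hu, hw]
        field_simp

/-- The linking rectangles of the construction with the parameters `k` and `4 ^ k`. -/
noncomputable def linkFamily (k : ℕ) : Finset DyadicRect :=
  Finset.univ.image (linkRect k k (4 ^ k))

/-- Different parameters live in the disjoint unit squares over `[k, k + 1)`; this lets a single
family of signs serve all `k`. -/
theorem integral_source_mul_haar_eq_zero {k k' : ℕ} (h : k ≠ k') {R : DyadicRect}
    (hR : R ∈ linkFamily k') : ∫ x, sourceFun k k (4 ^ k) x * haar R x = 0 := by
  obtain ⟨z, -, rfl⟩ := Finset.mem_image.1 hR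
  refine integral_eq_zero_of_ae (Filter.Eventually.of_forall fun x => ?_)
  by_cases hx : x ∈ (linkRect k' k' (4 ^ k') z).toSet
  · have : sourceFun k k (4 ^ k) x = 0 := by
      refine bumpSum_eq_zero fun c hc => h ?_
      have h1 := cell_antitone _ _ (Nat.zero_le _) hx.1
      have h2 := cell_antitone _ _ (Nat.zero_le _) hc.1
      have := DyadicInterval.eq_of_mem (I := cell k _ 0) (J := cell k' _ 0) rfl h2 h1
      simpa [cell, prefixCode] using this
    simp [this]
  · simp [haar_eq_zero hx]

open Classical in
/-- The indicator function of the set of all linking rectangles. -/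
noncomputable def linkSign (R : DyadicRect) : ℝ := if ∃ k, R ∈ linkFamily k then 1 else 0

theorem abs_linkSign_le (R : DyadicRect) : |linkSign R| ≤ 1 := by
  unfold linkSign
  split_ifs <;> simp

theorem martingaleTransform_linkSign_ae (k : ℕ) :
    martingaleTransform linkSign (sourceFun k k (4 ^ k)) =ᵐ[volume]
      fun x => ∑ R ∈ linkFamily k, (∫ y, sourceFun k k (4 ^ k) y * haar R y) * haar R x := by
  have h1 : ∀ R ∉ linkFamily k,
      (linkSign R * ∫ x, sourceFun k k (4 ^ k) x * haar R x) •
        (memLp_haar R).toLp (haar R) = 0 := by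
    intro R hR
    by_cases h : ∃ k', R ∈ linkFamily k'
    · obtain ⟨k', hk'⟩ := h
      have hne : k ≠ k' := fun h => hR (h ▸ hk')
      rw [integral_source_mul_haar_eq_zero hne hk', mul_zero, zero_smul]
    · rw [linkSign, if_neg h, zero_mul, zero_smul]
  unfold martingaleTransform
  -- All terms outside the finite family vanish, so no convergence question arises.
  rw [tsum_eq_sum h1]
  refine (Lp.coeFn_finsetSum _ _).trans ?_
  have h2 : ∀ R ∈ linkFamily k, ∀ᵐ x : ℝ × ℝ,
      ((linkSign R * ∫ x, sourceFun k k (4 ^ k) x * haar R x) •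
        (memLp_haar R).toLp (haar R) : Lp ℝ 2 (volume : Measure (ℝ × ℝ))) x =
      (∫ y, sourceFun k k (4 ^ k) y * haar R y) * haar R x := by
    intro R hR
    filter_upwards [Lp.coeFn_smul (linkSign R * ∫ x, sourceFun k k (4 ^ k) x * haar R x)
      ((memLp_haar R).toLp (haar R)), (memLp_haar R).coeFn_toLp] with x h3 h4
    rw [h3, Pi.smul_apply, h4, linkSign, if_pos ⟨k, hR⟩, one_mul, smul_eq_mul]
  filter_upwards [(Finset.eventually_all _).2 h2] with x hx
  rw [Finset.sum_apply]
  exact Finset.sum_congr rfl hx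

theorem integral_martingaleTransform {k : ℕ} (hk : 1 ≤ k) :
    ∫ x, martingaleTransform linkSign (sourceFun k k (4 ^ k)) x * targetFun k k (4 ^ k) x =
      2 ^ k := by
  have hint : ∀ R ∈ linkFamily k, Integrable fun x =>
      (∫ y, sourceFun k k (4 ^ k) y * haar R y) * (targetFun k k (4 ^ k) x * haar R x) :=
    fun R _ => ((memLp_bumpSum _ _ 2).integrable_mul (memLp_haar R)).const_mul _
  calc _ = ∫ x, ∑ R ∈ linkFamily k, (∫ y, sourceFun k k (4 ^ k) y * haar R y) *
        (targetFun k k (4 ^ k) x * haar R x) := by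
        refine integral_congr_ae ?_
        filter_upwards [martingaleTransform_linkSign_ae k] with x hx
        rw [hx, Finset.sum_mul]
        refine Finset.sum_congr rfl fun R _ => ?_
        ring
    _ = ∑ R ∈ linkFamily k, (∫ y, sourceFun k k (4 ^ k) y * haar R y) *
        ∫ x, targetFun k k (4 ^ k) x * haar R x := by
        rw [integral_finsetSum _ hint]
        simp only [integral_const_mul]
    _ = ∑ z : (Fin (4 ^ k + k) → Bool) × Fin (4 ^ k),
        (2 : ℝ) ^ k / (2 ^ (4 ^ k + k) * (4 ^ k : ℕ)) := by
        rw [linkFamily, Finset.sum_image fun z _ z' _ h => linkRect_injective _ hk h]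
        exact Finset.sum_congr rfl fun z _ => integral_source_mul_integral_target _ hk z
    _ = 2 ^ k := by
        simp
        field_simp

/-! ### Conclusion -/

/-- The pairing grows like `2 ^ k` while every sparse form is bounded by a constant times `4 ^ (α *
k)`, with the constant independent of `k` and of the sparse collection. -/
theorem not_hasSparseDomination {α : ℝ} (hα₀ : 0 < α) (hα₁ : α < 1 / 2)
    {T : (ℝ × ℝ → ℝ) → ℝ × ℝ → ℝ}
    (hT : ∀ k : ℕ, 1 ≤ k →
      2 ^ k ≤ ∫ x, T (sourceFun k k (4 ^ k)) x * targetFun k k (4 ^ k) x) :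
    ¬ HasSparseDomination (fun x => x * (Real.log (Real.exp 1 + x)) ^ α) T := by
  rintro ⟨C, hC, η, hη, -, h⟩
  have hK : (ENNReal.ofReal η)⁻¹ * (weightMass * weightMass) ≠ ∞ :=
    ENNReal.mul_ne_top (by simpa using hη)
      (ENNReal.mul_ne_top weightMass_ne_top weightMass_ne_top)
  obtain ⟨K, hK'⟩ : ∃ K : ℝ, K = ((ENNReal.ofReal η)⁻¹ * (weightMass * weightMass)).toReal :=
    ⟨_, rfl⟩
  have hK0 : 0 ≤ K := hK' ▸ ENNReal.toReal_nonneg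
  have hbound : ∀ k : ℕ, 1 ≤ k → (2 : ℝ) ^ k ≤ C * ((5 * depth k (4 ^ k) : ℝ) ^ α * K) := by
    intro k hk
    obtain ⟨S, hS, hle⟩ := h _ _
      (isTestFunction_bumpSum (Q := sourceSquare k k (4 ^ k)) (sourceFun_value_nonneg k (4 ^ k)))
      (isTestFunction_bumpSum (Q := targetSquare k k (4 ^ k)) (targetFun_value_nonneg k (4 ^ k)))
    have h1 := sparseForm_le hα₀.le (by linarith : α ≤ 1) k (k := k) rfl hη hS
    have h2 : ENNReal.ofReal (2 ^ k) ≤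
        ENNReal.ofReal (C * ((5 * depth k (4 ^ k) : ℝ) ^ α * K)) := by
      rw [ENNReal.ofReal_mul hC.le, ENNReal.ofReal_mul (by positivity), hK',
        ENNReal.ofReal_toReal hK]
      refine le_trans (ENNReal.ofReal_le_ofReal ?_) (hle.trans (mul_le_mul_right h1 _))
      exact (hT k hk).trans (le_abs_self _)
    exact (ENNReal.ofReal_le_ofReal_iff (by positivity)).1 h2
  have hdepth : ∀ k : ℕ, (5 * depth k (4 ^ k) : ℝ) ^ α ≤ 20 ^ α * ((4 : ℝ) ^ α) ^ k := by
    intro k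
    have h1 : depth k (4 ^ k) ≤ 4 * 4 ^ k := by
      have : k < 4 ^ k := Nat.lt_pow_self (by norm_num)
      unfold depth
      omega
    have h2 : (depth k (4 ^ k) : ℝ) ≤ 4 * 4 ^ k := by exact_mod_cast h1
    calc (5 * depth k (4 ^ k) : ℝ) ^ α ≤ (20 * 4 ^ k : ℝ) ^ α :=
          Real.rpow_le_rpow (by positivity) (by linarith) hα₀.le
      _ = 20 ^ α * ((4 : ℝ) ^ α) ^ k := by
          rw [Real.mul_rpow (by positivity) (by positivity), ← Real.rpow_natCast,
            ← Real.rpow_natCast, ← Real.rpow_mul (by norm_num), ← Real.rpow_mul (by norm_num),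
            mul_comm α]
  have h4 : (4 : ℝ) ^ α < 2 := by
    calc (4 : ℝ) ^ α < 4 ^ (1 / 2 : ℝ) := Real.rpow_lt_rpow_of_exponent_lt (by norm_num) hα₁
      _ = 2 := by
        rw [← Real.sqrt_eq_rpow, show (4 : ℝ) = 2 ^ 2 by norm_num]
        exact Real.sqrt_sq (by norm_num)
  have h40 : (0 : ℝ) < 4 ^ α := by positivity
  have hq : 1 < 2 / (4 : ℝ) ^ α := (one_lt_div h40).2 h4
  obtain ⟨n, hn⟩ := pow_unbounded_of_one_lt (C * (20 ^ α * K)) hq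
  -- Passing to `n + 1` secures the condition `1 ≤ k` of `hbound`.
  have h5 : C * (20 ^ α * K) < (2 / (4 : ℝ) ^ α) ^ (n + 1) :=
    hn.trans (pow_lt_pow_right₀ hq n.lt_succ_self)
  rw [div_pow, lt_div_iff₀ (by positivity)] at h5
  refine absurd (hbound (n + 1) (by omega)) (not_le.2 (lt_of_le_of_lt ?_ h5))
  calc C * ((5 * depth (n + 1) (4 ^ (n + 1)) : ℝ) ^ α * K)
      ≤ C * (20 ^ α * ((4 : ℝ) ^ α) ^ (n + 1) * K) := by
        gcongr
        exact hdepth (n + 1)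
    _ = _ := by ring

end SparseForms

open SparseForms
theorem theorem4p4 (α : ℝ) (hα₀ : 0 < α) (hα₁ : α < 1 / 2) :
    (¬ HasSparseDomination (fun x => x * (Real.log (Real.exp 1 + x)) ^ α) strongMaximal) ∧
    ∃ σ : DyadicRect → ℝ, (∀ R, |σ R| ≤ 1) ∧
      ¬ HasSparseDomination (fun x => x * (Real.log (Real.exp 1 + x)) ^ α)
        (martingaleTransform σ) :=
  ⟨not_hasSparseDomination hα₀ hα₁ fun k _ => two_pow_le_integral_strongMaximal k (by positivity),
    linkSign, abs_linkSign_le,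
    not_hasSparseDomination hα₀ hα₁ fun _ hk => (integral_martingaleTransform hk).ge⟩
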